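/- For $q\in(1,2]$ and a sequence $(d_i)_{i\ge1}\in\{0,1\}^{\mathbb N}$ write $(d_1d_2\dots)_q=\sum_{i\ge1}d_iq^{-i}$. For $x>0$ let $\mathscr U(x)$ be the set of $q\in(1,2]$ for which there is exactly one sequence $(d_i)\in\{0,1\}^{\mathbb N}$ with $(d_1d_2\dots)_q=x$, let $q_s(x)=\inf\mathscr U(x)$, and let $L(q)=\{x>0:q_s(x)=q\}$. Let $(\tau_i)_{i\ge0}$ be the Thue–Morse sequence ($\tau_i$ is the parity of the number of ones in the binary representation of $i$), and let $q_{KL}$ be the Komornik–Loreti constant, i.e. the unique $q\in(1,2)$ with $\sum_{i\ge1}\tau_iq^{-i}=1$. Define $S\subset\mathbb N=\{1,2,\dots\}$ recursively as follows: among the numbers $n\le4$ exactly $2,3,4$ belong to $S$; for $k\ge2$ and $2^k<n\le2^{k+1}$, $n\in S$ if and only if $n>3\cdot2^{k-1}$ and $n-3\cdot2^{k-1}\in S$. For $n\in\mathbb N$ put $$x_n=(\tau_n\tau_{n+1}\dots)_{q_{KL}},\qquad x_n'=(0\,\tau_n\tau_{n+1}\dots)_{q_{KL}},\qquad x_n''=(00\,\tau_n\tau_{n+1}\dots)_{q_{KL}}.$$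 **Theorem.** The level set $L(q_{KL})$ is infinite. Furthermore, for every $n\in\mathbb N$: (i) $q_s(x_n)=q_{KL}$ if and only if $n\in S\cup\{1\}$. (ii) If $\tau_n=1$, then $q_s(x_n')=q_{KL}$ if and only if $n\in S$. (iii) $q_s(x_n'')=q_{KL}$ if and only if $n\in S$ and $\tau_n\tau_{n+1}\dots\tau_{n+6}=1010011$. (iv) If $x$ is one of $x_n,x_n',x_n''$ and $q_s(x)=q_{KL}$, then $q_{KL}=\min\mathscr U(x)$ (the infimum is attained). Moreover, the set $S$ has density zero: $\frac1n\#\{m\in S: 1\le m\le n\}\to0$ as $n\to\infty$. -/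

import Mathlib

open Filter Topology

namespace ThueMorseBases

/-- The value `(d₁d₂d₃…)_q = ∑_{i ≥ 1} dᵢ / qⁱ` of a sequence of binary digits in base `q`.
Sequences are indexed from `0`, so `d i` is the digit with weight `q⁻⁽ⁱ⁺¹⁾`.
The series converges for every `q > 1`. -/
noncomputable def value (q : ℝ) (d : ℕ → Fin 2) : ℝ :=
  ∑' i : ℕ, ((d i : ℕ) : ℝ) / q ^ (i + 1)

/-- The set `𝒰(x)` of bases `q ∈ (1, 2]` in which `x` has exactly one expansion with digits
`0` and `1`. -/
def univoqueBases (x : ℝ) : Set ℝ :=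
  {q : ℝ | 1 < q ∧ q ≤ 2 ∧ ∃! d : ℕ → Fin 2, value q d = x}

/-- The smallest univoque base `q_s(x) = inf 𝒰(x)`. -/
noncomputable def qs (x : ℝ) : ℝ := sInf (univoqueBases x)

/-- The level set `L(q) = {x > 0 : q_s(x) = q}`. -/
def levelSet (q : ℝ) : Set ℝ := {x : ℝ | 0 < x ∧ qs x = q}

/-- The Thue–Morse sequence `τ₀τ₁τ₂…`: `τᵢ` is the parity of the number of ones in the binary
representation of `i`. -/
def tau (i : ℕ) : Fin 2 := ⟨(Nat.digits 2 i).sum % 2, Nat.mod_lt _ two_pos⟩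

/-! ### The Komornik–Loreti constant -/

theorem term_le {q : ℝ} (hq : 1 < q) (d : ℕ → Fin 2) (i : ℕ) :
    ((d i : ℕ) : ℝ) / q ^ (i + 1) ≤ (q⁻¹) ^ (i + 1) := by
  have h : ((d i : ℕ) : ℝ) ≤ 1 := by exact_mod_cast Nat.lt_succ_iff.mp (d i).isLt
  rw [inv_pow, div_eq_mul_inv]
  have : 0 ≤ (q ^ (i + 1))⁻¹ := by positivity
  nlinarith

theorem summable_geom {q : ℝ} (hq : 1 < q) : Summable fun i : ℕ => (q⁻¹) ^ (i + 1) :=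
  (summable_nat_add_iff 1).mpr
    (summable_geometric_of_lt_one (by positivity) (inv_lt_one_of_one_lt₀ hq))

theorem summable_value {q : ℝ} (hq : 1 < q) (d : ℕ → Fin 2) :
    Summable fun i : ℕ => ((d i : ℕ) : ℝ) / q ^ (i + 1) :=
  Summable.of_nonneg_of_le (fun i => by positivity) (term_le hq d) (summable_geom hq)

theorem existsUnique_qKL :
    ∃! q : ℝ, 1 < q ∧ q < 2 ∧ value q (fun i => tau (i + 1)) = 1 := by
  set d : ℕ → Fin 2 := fun i => tau (i + 1) with hd
  have h0 : d 0 = 1 := by simp [hd, tau]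
  have h1 : d 1 = 1 := by simp [hd, tau]
  have h2 : d 2 = 0 := by simp [hd, tau]
  have anti : ∀ p q : ℝ, 1 < p → p < q → value q d < value p d := by
    intro p q hp hpq
    refine Summable.tsum_lt_tsum (i := 0) (fun i => ?_) ?_
      (summable_value (hp.trans hpq) d) (summable_value hp d)
    · have : 0 < p := by linarith
      exact div_le_div_of_nonneg_left (by positivity) (by positivity)
        (pow_le_pow_left₀ this.le hpq.le _)
    · have : 0 < p := by linarith
      simp only [h0]
      norm_num
      exact inv_strictAnti₀ this hpq
  have cont : ContinuousOn (fun q : ℝ => value q d) (Set.Icc (3 / 2) 2) := by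
    refine continuousOn_tsum (u := fun i : ℕ => ((3 / 2 : ℝ)⁻¹) ^ (i + 1)) (fun i => ?_)
      (summable_geom (by norm_num)) (fun i q hq => ?_)
    · refine ContinuousOn.div continuousOn_const (by fun_prop) (fun q hq => ?_)
      have : 0 < q := by linarith [hq.1]
      positivity
    · have hq0 : 0 < q := by linarith [hq.1]
      rw [Real.norm_of_nonneg (by positivity)]
      refine (term_le (by linarith [hq.1]) d i).trans ?_
      exact pow_le_pow_left₀ (by positivity) (inv_anti₀ (by norm_num) hq.1) _
  have hlow : 1 < value (3 / 2) d := by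
    have := (summable_value (by norm_num : (1 : ℝ) < 3 / 2) d).sum_le_tsum (Finset.range 2)
      (fun i _ => by positivity)
    refine lt_of_lt_of_le ?_ this
    simp only [Finset.sum_range_succ, Finset.sum_range_zero, h0, h1]
    norm_num
  have hhigh : value 2 d < 1 := by
    have hs : ∑' i : ℕ, ((2 : ℝ)⁻¹) ^ (i + 1) = 1 := by
      simp_rw [pow_succ]
      rw [tsum_mul_right, tsum_geometric_of_lt_one (by norm_num) (by norm_num)]
      norm_num
    rw [← hs]
    refine Summable.tsum_lt_tsum (i := 2) (term_le (by norm_num) d) ?_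
      (summable_value (by norm_num) d) (summable_geom (by norm_num))
    simp only [h2]
    norm_num
  obtain ⟨q, hq, hq1⟩ := intermediate_value_Icc' (by norm_num) cont ⟨hhigh.le, hlow.le⟩
  have hq1 : value q d = 1 := hq1
  refine ⟨q, ⟨by linarith [hq.1], lt_of_le_of_ne hq.2 ?_, hq1⟩, ?_⟩
  · rintro rfl
    exact hhigh.ne hq1
  · rintro p ⟨hp1, -, hp⟩
    rcases lt_trichotomy p q with h | h | h
    · exact absurd (anti p q hp1 h) (by rw [hp, hq1]; exact lt_irrefl _)
    · exact h
    · exact absurd (anti q p (by linarith [hq.1]) h) (by rw [hp, hq1]; exact lt_irrefl _)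

/-- The Komornik–Loreti constant: the unique `q ∈ (1, 2)` with `∑_{i ≥ 1} τᵢ / qⁱ = 1`. -/
noncomputable def qKL : ℝ := existsUnique_qKL.choose

theorem qKL_spec : 1 < qKL ∧ qKL < 2 ∧ value qKL (fun i => tau (i + 1)) = 1 :=
  existsUnique_qKL.choose_spec.1

/-! ### The points and the index set -/

/-- The number `(0…0 τ_n τ_{n+1} …)_{q_KL}` with `k` leading zeros. For `k = 0, 1, 2` these are
the points `x_n`, `x_n'`, `x_n''`. -/
noncomputable def point (k n : ℕ) : ℝ :=
  value qKL (fun i => if i < k then 0 else tau (n + (i - k)))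

/-- Membership in the recursively defined set `S`: the numbers `2, 3, 4` belong to `S`, and for
`k ≥ 2` a number `n` with `2 ^ k < n ≤ 2 ^ (k + 1)` belongs to `S` if and only if
`n > 3 * 2 ^ (k - 1)` and `n - 3 * 2 ^ (k - 1)` belongs to `S`. -/
inductive MemS : ℕ → Prop
  | two : MemS 2
  | three : MemS 3
  | four : MemS 4
  | step (k n : ℕ) (hk : 2 ≤ k) (hlo : 2 ^ k < n) (hhi : n ≤ 2 ^ (k + 1))
      (h : 3 * 2 ^ (k - 1) < n) (hmem : MemS (n - 3 * 2 ^ (k - 1))) : MemS n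

/-- The set `S = {2, 3, 4, 8, 14, 15, 16, 26, 27, 28, 32, …}`. -/
def S : Set ℕ := {n | MemS n}

/-- The recursive clause of `S` as an equivalence. -/
theorem mem_S_iff {k n : ℕ} (hk : 2 ≤ k) (hlo : 2 ^ k < n) (hhi : n ≤ 2 ^ (k + 1)) :
    n ∈ S ↔ 3 * 2 ^ (k - 1) < n ∧ n - 3 * 2 ^ (k - 1) ∈ S := by
  have h4 : 2 ^ 2 ≤ 2 ^ k := Nat.pow_le_pow_right two_pos hk
  constructor
  · intro h
    cases (show MemS n from h) with
    | two => omega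
    | three => omega
    | four => omega
    | step k' _ hk' hlo' hhi' h' hmem' =>
      have e1 : k < k' + 1 :=
        (Nat.pow_lt_pow_iff_right (a := 2) (by norm_num)).mp (hlo.trans_le hhi')
      have e2 : k' < k + 1 :=
        (Nat.pow_lt_pow_iff_right (a := 2) (by norm_num)).mp (hlo'.trans_le hhi)
      obtain rfl : k = k' := by omega
      exact ⟨h', hmem'⟩
  · rintro ⟨h, hm⟩
    exact MemS.step k n hk hlo hhi h hm

end ThueMorseBases

/-! An expansion in base q is unique exactly when every tail after a digit 0, and every reflected
tail after a digit 1, has value less than 1 (`mem_univoqueBases_iff`, `Univoque`). In base `qKL` the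
sequence τ₁τ₂… has value 1 and lexicographically dominates all these tails of the Thue–Morse
sequence (`lexLT_tm`), so the given expansions are unique there. This gives attainment; what remains
is to decide when a smaller base exists.

Let p_k < `qKL` be a base in which τ₁…τ_{2^k} has value 1 (`exists_base`). The periodic repetition
of τ₀…τ_{2^k-1} is univoque in every base above p_k, even when preceded by most of a reflected block
(`univoque_periodic`, `univoque_flipped`). If such a sequence has value above x in base p_k and
below x in base `qKL`, continuity gives a univoque base of x below `qKL` (`exists_univoque_lt`). The
recursive set `S` is the set of n ≥ 2 for which the two obvious ways of doing this both fail: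
`mem_S_iff_conditions` translates it into `BlocksReflected` and `StartsReflected`.

Conversely, let x have a univoque expansion in some q < `qKL`. It is lexicographically smaller than
the expansion in base `qKL` (`exists_first_difference`), and univoqueness forces the first
difference to sit at the start of a block of some length 2^k (`exists_block_of_first_difference`)
and forces q > p_k when k ≥ 1 (`trunc_lt_one_of_block`). Since the tail after the differing 0 is
less than 1, x is less than the number obtained by rounding up at that place. For k ≥ 2 and n ∈ `S`,
this is bounded by the value of a periodic sequence in base p_k, and `rval_periodic_le_tmValue`
shows that value to be at most x, a contradiction (`no_small_base`). The cases k ≤ 1 are numerical.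

Two leading zeros bring in one borderline case, where n is the third index of a block (offset 2). It
is settled by the digits 1010011: with them `sub_one_div_sq_le_tmValue` excludes a smaller base,
without them `exists_of_not_hasPrefix` produces one. Infinitude comes from the powers of 2 in `S`,
and density zero from the Fibonacci-type recursion `ncard_S_step`. -/

namespace ThueMorseBases

/-! ### Real-valued digit sequences -/

/-- The value `∑ aᵢ / qⁱ⁺¹` of a real sequence in base `q`. -/
noncomputable def rval (q : ℝ) (a : ℕ → ℝ) : ℝ := ∑' i : ℕ, a i / q ^ (i + 1)

/-- All entries of the sequence are `0` or `1`. -/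
def IsDigits (a : ℕ → ℝ) : Prop := ∀ i, a i = 0 ∨ a i = 1

theorem IsDigits.nonneg {a : ℕ → ℝ} (ha : IsDigits a) (i : ℕ) : 0 ≤ a i := by
  rcases ha i with h | h <;> simp [h]

theorem IsDigits.le_one {a : ℕ → ℝ} (ha : IsDigits a) (i : ℕ) : a i ≤ 1 := by
  rcases ha i with h | h <;> simp [h]

theorem IsDigits.shift {a : ℕ → ℝ} (ha : IsDigits a) (n : ℕ) : IsDigits (fun l => a (n + l)) :=
  fun _ => ha _

theorem IsDigits.compl {a : ℕ → ℝ} (ha : IsDigits a) : IsDigits (fun l => 1 - a l) := by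
  intro i
  rcases ha i with h | h <;> simp [h]

theorem hasSum_geom {q : ℝ} (hq : 1 < q) :
    HasSum (fun i : ℕ => 1 / q ^ (i + 1)) (1 / (q - 1)) := by
  have h := (hasSum_geometric_of_lt_one (r := q⁻¹) (by positivity)
    (inv_lt_one_of_one_lt₀ hq)).mul_right q⁻¹
  have e : (1 - q⁻¹)⁻¹ * q⁻¹ = 1 / (q - 1) := by
    have : q - 1 ≠ 0 := by linarith
    have h2 : q ≠ 0 := by linarith
    field_simp
  rw [e] at h
  refine h.congr_fun ?_
  intro i
  simp [pow_succ, mul_comm]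

theorem IsDigits.summable {q : ℝ} (hq : 1 < q) {a : ℕ → ℝ} (ha : IsDigits a) :
    Summable fun i : ℕ => a i / q ^ (i + 1) := by
  refine Summable.of_nonneg_of_le (fun i => ?_) (fun i => ?_) (hasSum_geom hq).summable
  · have := ha.nonneg i
    positivity
  · have := ha.le_one i
    gcongr

theorem rval_nonneg {q : ℝ} (hq : 1 < q) {a : ℕ → ℝ} (ha : IsDigits a) : 0 ≤ rval q a :=
  tsum_nonneg fun i => by
    have := ha.nonneg i
    positivity

theorem rval_compl {q : ℝ} (hq : 1 < q) {a : ℕ → ℝ} (ha : IsDigits a) :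
    rval q (fun l => 1 - a l) = 1 / (q - 1) - rval q a := by
  unfold rval
  rw [← (hasSum_geom hq).tsum_eq, ← (hasSum_geom hq).summable.tsum_sub (ha.summable hq)]
  exact tsum_congr fun i => by ring

theorem rval_le {q : ℝ} (hq : 1 < q) {a : ℕ → ℝ} (ha : IsDigits a) :
    rval q a ≤ 1 / (q - 1) := by
  have := rval_nonneg hq ha.compl
  rw [rval_compl hq ha] at this
  linarith

theorem rval_split {q : ℝ} (hq : 1 < q) {a : ℕ → ℝ} (ha : IsDigits a) (N : ℕ) :
    rval q a = ∑ i ∈ Finset.range N, a i / q ^ (i + 1) +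
      rval q (fun l => a (N + l)) / q ^ N := by
  unfold rval
  rw [← (ha.summable hq).sum_add_tsum_nat_add N, ← tsum_div_const]
  congr 1
  refine tsum_congr fun i => ?_
  rw [add_comm i N, div_div, ← pow_add]
  congr 2
  ring

theorem rval_cons {q : ℝ} (hq : 1 < q) {a : ℕ → ℝ} (ha : IsDigits a) :
    rval q a = (a 0 + rval q (fun l => a (1 + l))) / q := by
  rw [rval_split hq ha 1]
  simp
  ring

theorem rval_shift_cons {q : ℝ} (hq : 1 < q) {a : ℕ → ℝ} (ha : IsDigits a) (n : ℕ) :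
    rval q (fun l => a (n + l)) = (a n + rval q (fun l => a (n + 1 + l))) / q := by
  rw [rval_cons hq (ha.shift n)]
  simp [add_assoc]

theorem rval_pos {q : ℝ} (hq : 1 < q) {a : ℕ → ℝ} (ha : IsDigits a) {i : ℕ} (hi : a i = 1) :
    0 < rval q a := by
  refine (ha.summable hq).tsum_pos (fun j => ?_) i ?_
  · have := ha.nonneg j
    positivity
  · rw [hi]
    positivity

theorem sum_anti {p q : ℝ} (hp : 1 < p) (hpq : p ≤ q) {a : ℕ → ℝ} (ha : IsDigits a) (N : ℕ) :
    ∑ i ∈ Finset.range N, a i / q ^ (i + 1) ≤ ∑ i ∈ Finset.range N, a i / p ^ (i + 1) := by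
  refine Finset.sum_le_sum fun i _ => ?_
  have := ha.nonneg i
  gcongr

theorem rval_anti {p q : ℝ} (hp : 1 < p) (hpq : p ≤ q) {a : ℕ → ℝ} (ha : IsDigits a) :
    rval q a ≤ rval p a := by
  refine (ha.summable (hp.trans_le hpq)).tsum_le_tsum (fun i => ?_) (ha.summable hp)
  have := ha.nonneg i
  gcongr

theorem rval_strictAnti {p q : ℝ} (hp : 1 < p) (hpq : p < q) {a : ℕ → ℝ} (ha : IsDigits a)
    {i : ℕ} (hi : a i = 1) : rval q a < rval p a := by
  refine Summable.tsum_lt_tsum (i := i) (fun j => ?_) ?_ (ha.summable (hp.trans hpq))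
    (ha.summable hp)
  · have := ha.nonneg j
    gcongr
  · rw [hi]
    gcongr

theorem continuousOn_rval {p r : ℝ} (hp : 1 < p) {a : ℕ → ℝ} (ha : IsDigits a) :
    ContinuousOn (fun q : ℝ => rval q a) (Set.Icc p r) := by
  refine continuousOn_tsum (u := fun i : ℕ => 1 / p ^ (i + 1)) (fun i => ?_)
    (hasSum_geom hp).summable (fun i q hq => ?_)
  · refine ContinuousOn.div continuousOn_const (by fun_prop) (fun q hq => ?_)
    have : 0 < q := by linarith [hq.1]
    positivity
  · have hq0 : 0 < q := by linarith [hq.1]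
    have := ha.nonneg i
    have := ha.le_one i
    rw [Real.norm_of_nonneg (by positivity)]
    have := hq.1
    gcongr

theorem rval_congr {q : ℝ} {a b : ℕ → ℝ} (h : ∀ i, a i = b i) : rval q a = rval q b := by
  rw [funext h]

/-- Leading zeros divide the value by a power of the base. -/
theorem rval_zeros {q : ℝ} (hq : 1 < q) {a : ℕ → ℝ} (ha : IsDigits a) {z : ℕ}
    (h : ∀ i < z, a i = 0) : rval q a = rval q (fun l => a (z + l)) / q ^ z := by
  rw [rval_split hq ha z, Finset.sum_eq_zero, zero_add]
  intro i hi
  rw [h i (Finset.mem_range.mp hi), zero_div]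

/-! ### Unique expansions -/

/-- Greedy remainders. -/
noncomputable def remainder (q y : ℝ) : ℕ → ℝ
  | 0 => y
  | n + 1 => q * remainder q y n - if 1 ≤ q * remainder q y n then 1 else 0

/-- The digits of the greedy expansion. -/
noncomputable def greedy (q y : ℝ) (n : ℕ) : ℝ := if 1 ≤ q * remainder q y n then 1 else 0

/-- Because q ≤ 2, the greedy step maps the interval [0, 1/(q-1)] into itself, so the remainders
stay bounded and their weights q⁻ⁿ kill them. -/
theorem exists_digits {q : ℝ} (hq : 1 < q) (hq2 : q ≤ 2) {y : ℝ} (hy : 0 ≤ y)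
    (hy2 : y ≤ 1 / (q - 1)) : ∃ a, IsDigits a ∧ rval q a = y := by
  have hd : IsDigits (greedy q y) := by
    intro i
    unfold greedy
    split_ifs <;> simp
  have hq1 : 0 < q - 1 := by linarith
  have hc : 1 ≤ 1 / (q - 1) := by
    rw [le_div_iff₀ hq1]
    linarith
  have he : q * (1 / (q - 1)) = 1 + 1 / (q - 1) := by
    field_simp
    ring
  have hb : ∀ n, 0 ≤ remainder q y n ∧ remainder q y n ≤ 1 / (q - 1) := by
    intro n
    induction n with
    | zero => exact ⟨hy, hy2⟩
    | succ n ih =>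
      have h1 : 0 ≤ q * remainder q y n := mul_nonneg (by linarith) ih.1
      have h2 : q * remainder q y n ≤ q * (1 / (q - 1)) :=
        mul_le_mul_of_nonneg_left ih.2 (by linarith)
      simp only [remainder]
      split_ifs with h
      · constructor <;> linarith
      · constructor <;> linarith
  have hs : ∀ n, ∑ i ∈ Finset.range n, greedy q y i / q ^ (i + 1) =
      y - remainder q y n / q ^ n := by
    intro n
    induction n with
    | zero => simp [remainder]
    | succ n ih =>
      rw [Finset.sum_range_succ, ih]
      simp only [remainder, greedy]
      have : q ≠ 0 := by linarith
      field_simp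
      ring
  refine ⟨_, hd, ?_⟩
  have h1 := (hd.summable hq).hasSum.tendsto_sum_nat
  simp_rw [hs] at h1
  refine tendsto_nhds_unique h1 ?_
  have h3 : Tendsto (fun n : ℕ => (1 / (q - 1)) * (q⁻¹) ^ n) atTop (𝓝 0) := by
    simpa using (tendsto_pow_atTop_nhds_zero_of_lt_one (r := q⁻¹) (by positivity)
      (inv_lt_one_of_one_lt₀ hq)).const_mul (1 / (q - 1))
  have h2 : Tendsto (fun n => remainder q y n / q ^ n) atTop (𝓝 0) := by
    refine squeeze_zero (fun n => ?_) (fun n => ?_) h3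
    · have := (hb n).1
      positivity
    · rw [inv_pow, ← div_eq_mul_inv]
      have := (hb n).2
      gcongr
  simpa using h2.const_sub y

/-- Every digit `0` is followed by a tail of value less than `1`, and every digit `1` by a tail
whose reflection has value less than `1`. This characterizes unique expansions. -/
def Univoque (q : ℝ) (a : ℕ → ℝ) : Prop :=
  ∀ i, (a i = 0 → rval q (fun l => a (i + 1 + l)) < 1) ∧
    (a i = 1 → 1 / (q - 1) - rval q (fun l => a (i + 1 + l)) < 1)

theorem Univoque.shift {q : ℝ} {a : ℕ → ℝ} (h : Univoque q a) (n : ℕ) :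
    Univoque q (fun l => a (n + l)) := by
  intro i
  have := h (n + i)
  simpa [add_assoc] using this

theorem Univoque.compl {q : ℝ} (hq : 1 < q) {a : ℕ → ℝ} (ha : IsDigits a) (h : Univoque q a) :
    Univoque q (fun l => 1 - a l) := by
  intro i
  have e := rval_compl hq (ha.shift (i + 1))
  constructor
  · intro h0
    rw [e]
    exact (h i).2 (by linarith)
  · intro h1
    rw [e]
    have := (h i).1 (by linarith)
    linarith

theorem exists_first_ne {a b : ℕ → ℝ} (h : a ≠ b) :
    ∃ i, (∀ j < i, a j = b j) ∧ a i ≠ b i := by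
  classical
  have h' : ∃ i, a i ≠ b i := Function.ne_iff.mp h
  exact ⟨Nat.find h', fun j hj => not_not.mp (Nat.find_min h' hj), Nat.find_spec h'⟩

/-- Behind the first differing digit the two tails would differ by exactly 1, which the bounds on
the tails of `a` leave no room for. -/
theorem Univoque.unique {q : ℝ} (hq : 1 < q) {a b : ℕ → ℝ} (ha : IsDigits a)
    (h : Univoque q a) (hb : IsDigits b) (hab : rval q b = rval q a) : b = a := by
  by_contra hne
  obtain ⟨i, hlt, hi⟩ := exists_first_ne hne
  rw [rval_split hq ha i, rval_split hq hb i, rval_shift_cons hq ha, rval_shift_cons hq hb,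
    Finset.sum_congr rfl fun j hj => by rw [hlt j (Finset.mem_range.mp hj)]] at hab
  have hq0 : q ≠ 0 := by linarith
  have hab : b i + rval q (fun l => b (i + 1 + l)) = a i + rval q (fun l => a (i + 1 + l)) := by
    have := add_left_cancel hab
    field_simp at this
    linarith
  have h1 := rval_nonneg hq (hb.shift (i + 1))
  have h2 := rval_le hq (hb.shift (i + 1))
  rcases ha i with h0 | h0 <;> rcases hb i with h0' | h0'
  · exact hi (by rw [h0, h0'])
  · have := (h i).1 h0
    linarith
  · have := (h i).2 h0
    linarith
  · exact hi (by rw [h0, h0'])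

/-- Replace the sequence from place `n` on. -/
noncomputable def splice (a b : ℕ → ℝ) (n i : ℕ) : ℝ := if i < n then a i else b (i - n)

theorem splice_lt {a b : ℕ → ℝ} {n i : ℕ} (h : i < n) : splice a b n i = a i := if_pos h

theorem splice_add {a b : ℕ → ℝ} {n i : ℕ} : splice a b n (n + i) = b i := by
  simp [splice]

theorem IsDigits.splice {a b : ℕ → ℝ} (ha : IsDigits a) (hb : IsDigits b) (n : ℕ) :
    IsDigits (splice a b n) := by
  intro i
  unfold ThueMorseBases.splice
  split_ifs
  · exact ha i
  · exact hb _

/-- If a bound failed at place i, the digit there could be flipped and the remainder, still in [0,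
1/(q-1)], expanded anew. -/
theorem univoque_of_unique {q : ℝ} (hq : 1 < q) (hq2 : q ≤ 2) {a : ℕ → ℝ} (ha : IsDigits a)
    (h : ∀ b, IsDigits b → rval q b = rval q a → b = a) : Univoque q a := by
  have key : ∀ i : ℕ, ∀ e : ℝ, (e = 0 ∨ e = 1) → e ≠ a i →
      ¬ (0 ≤ a i - e + rval q (fun l => a (i + 1 + l)) ∧
        a i - e + rval q (fun l => a (i + 1 + l)) ≤ 1 / (q - 1)) := by
    rintro i e he hea ⟨h1, h2⟩
    obtain ⟨c, hc, hcv⟩ := exists_digits hq hq2 h1 h2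
    have hec : IsDigits (splice (fun _ => e) c 1) := IsDigits.splice (fun _ => he) hc 1
    have hb := ha.splice hec i
    have := h _ hb ?_
    · apply hea
      rw [← this]
      have : splice a (splice (fun _ => e) c 1) i (i + 0) = e := by
        rw [splice_add, splice_lt one_pos]
      exact this.symm
    · rw [rval_split hq ha i, rval_split hq hb i, rval_shift_cons hq ha,
        Finset.sum_congr rfl fun j hj => by rw [splice_lt (Finset.mem_range.mp hj)]]
      simp only [splice_add]
      rw [rval_cons hq hec, splice_lt one_pos]
      simp only [splice_add]
      rw [show rval q (fun l => c l) = rval q c from rfl, hcv]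
      congr 3
      ring
  have hr := fun i => rval_nonneg hq (ha.shift (i + 1))
  have hr2 := fun i => rval_le hq (ha.shift (i + 1))
  intro i
  constructor
  · intro h0
    by_contra hge
    refine key i 1 (Or.inr rfl) (by rw [h0]; norm_num) ⟨?_, ?_⟩ <;>
    · rw [h0]
      linarith [hr2 i]
  · intro h1
    by_contra hge
    refine key i 0 (Or.inl rfl) (by rw [h1]; norm_num) ⟨?_, ?_⟩ <;>
    · rw [h1]
      linarith [hr i]

/-- The real digits of a binary sequence. -/
noncomputable def toReal (d : ℕ → Fin 2) (i : ℕ) : ℝ := ((d i : ℕ) : ℝ)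

theorem isDigits_toReal (d : ℕ → Fin 2) : IsDigits (toReal d) := by
  intro i
  unfold toReal
  generalize d i = e
  fin_cases e <;> simp

theorem toReal_injective : Function.Injective toReal := by
  intro d e h
  funext i
  have := congrFun h i
  simp only [toReal, Nat.cast_inj] at this
  exact Fin.ext this

theorem exists_toReal {a : ℕ → ℝ} (ha : IsDigits a) : ∃ d, toReal d = a := by
  classical
  refine ⟨fun i => if a i = 0 then 0 else 1, funext fun i => ?_⟩
  rcases ha i with h | h <;> simp [toReal, h]

theorem mem_univoqueBases_iff {q x : ℝ} : q ∈ univoqueBases x ↔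
    1 < q ∧ q ≤ 2 ∧ ∃ a, IsDigits a ∧ Univoque q a ∧ rval q a = x := by
  simp only [univoqueBases, Set.mem_ofPred_eq]
  refine and_congr_right fun hq => and_congr_right fun hq2 => ?_
  constructor
  · rintro ⟨d, hd, hu⟩
    refine ⟨toReal d, isDigits_toReal d, univoque_of_unique hq hq2 (isDigits_toReal d) ?_, hd⟩
    intro b hb hbv
    obtain ⟨e, rfl⟩ := exists_toReal hb
    rw [hu e (hbv.trans hd)]
  · rintro ⟨a, ha, hau, hav⟩
    obtain ⟨d, rfl⟩ := exists_toReal ha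
    refine ⟨d, hav, fun e he => toReal_injective ?_⟩
    exact hau.unique hq ha (isDigits_toReal e) (by rw [hav]; exact he)

/-! ### The Thue–Morse sequence -/

/-- The Thue–Morse sequence with real values. -/
noncomputable def tm : ℕ → ℝ := toReal tau

theorem isDigits_tm : IsDigits tm := isDigits_toReal tau

theorem tau_two_mul (i : ℕ) : tau (2 * i) = tau i := by
  rcases Nat.eq_zero_or_pos i with rfl | hi
  · rfl
  · refine Fin.ext ?_
    simp only [tau]
    rw [Nat.digits_def' (b := 2) (by norm_num) (by omega : 0 < 2 * i)]
    simp

theorem tau_two_mul_add_one (i : ℕ) : (tau (2 * i + 1) : ℕ) = 1 - (tau i : ℕ) := by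
  simp only [tau]
  rw [Nat.digits_def' (b := 2) (by norm_num) (by omega : 0 < 2 * i + 1)]
  have h1 : (2 * i + 1) % 2 = 1 := by omega
  have h2 : (2 * i + 1) / 2 = i := by omega
  rw [h1, h2, List.sum_cons]
  omega

theorem tm_zero : tm 0 = 0 := by simp [tm, toReal, tau]

theorem tm_even (i : ℕ) : tm (2 * i) = tm i := by
  simp only [tm, toReal, tau_two_mul]

theorem tm_odd (i : ℕ) : tm (2 * i + 1) = 1 - tm i := by
  simp only [tm, toReal, tau_two_mul_add_one]
  rw [Nat.cast_sub (Nat.lt_succ_iff.mp (tau i).isLt)]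
  simp

theorem tm_one : tm 1 = 1 := by simpa [tm_zero] using tm_odd 0
theorem tm_two : tm 2 = 1 := by simpa [tm_one] using tm_even 1
theorem tm_three : tm 3 = 0 := by simpa [tm_one] using tm_odd 1
theorem tm_four : tm 4 = 1 := by simpa [tm_two] using tm_even 2
theorem tm_five : tm 5 = 0 := by simpa [tm_two] using tm_odd 2
theorem tm_six : tm 6 = 0 := by simpa [tm_three] using tm_even 3
theorem tm_seven : tm 7 = 1 := by simpa [tm_three] using tm_odd 3

theorem tau_eq_iff {i : ℕ} {e : Fin 2} : tau i = e ↔ tm i = ((e : ℕ) : ℝ) := by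
  simp only [tm, toReal, Nat.cast_inj]
  exact ⟨fun h => by rw [h], fun h => Fin.ext h⟩

/-- Exclusive or of real digits. -/
def rxor (b c : ℝ) : ℝ := b + c - 2 * b * c

theorem rxor_zero_left (c : ℝ) : rxor 0 c = c := by simp [rxor]
theorem rxor_one_left (c : ℝ) : rxor 1 c = 1 - c := by simp [rxor]; ring
theorem rxor_compl_right (b c : ℝ) : rxor b (1 - c) = 1 - rxor b c := by simp [rxor]; ring
theorem rxor_zero_right (b : ℝ) : rxor b 0 = b := by simp [rxor]
theorem rxor_one_right (b : ℝ) : rxor b 1 = 1 - b := by simp [rxor]; ring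

theorem tm_block (k : ℕ) : ∀ a i : ℕ, i < 2 ^ k → tm (2 ^ k * a + i) = rxor (tm a) (tm i) := by
  induction k with
  | zero =>
    intro a i hi
    obtain rfl : i = 0 := by simpa using hi
    simp [tm_zero, rxor_zero_right]
  | succ k ih =>
    intro a i hi
    rw [pow_succ] at hi ⊢
    rcases Nat.even_or_odd' i with ⟨j, rfl | rfl⟩
    · rw [show 2 ^ k * 2 * a + 2 * j = 2 * (2 ^ k * a + j) by ring, tm_even, tm_even,
        ih a j (by omega)]
    · rw [show 2 ^ k * 2 * a + (2 * j + 1) = 2 * (2 ^ k * a + j) + 1 by ring, tm_odd, tm_odd,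
        ih a j (by omega), rxor_compl_right]

theorem tm_pow_mul (k a : ℕ) : tm (2 ^ k * a) = tm a := by
  simpa [tm_zero, rxor_zero_right] using tm_block k a 0 (by positivity)

theorem tm_pow (k : ℕ) : tm (2 ^ k) = 1 := by simpa [tm_one] using tm_pow_mul k 1

theorem tm_block_zero {k a i : ℕ} (hi : i < 2 ^ k) (h : tm a = 0) :
    tm (2 ^ k * a + i) = tm i := by
  rw [tm_block k a i hi, h, rxor_zero_left]

theorem tm_block_one {k a i : ℕ} (hi : i < 2 ^ k) (h : tm a = 1) :
    tm (2 ^ k * a + i) = 1 - tm i := by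
  rw [tm_block k a i hi, h, rxor_one_left]

/-- Three consecutive equal digits do not occur. -/
theorem tm_no_cube {n : ℕ} (h : tm n = tm (n + 1)) :
    tm (n + 2) = 1 - tm n ∧ ∃ b, n = 2 * b + 1 := by
  rcases Nat.even_or_odd' n with ⟨j, rfl | rfl⟩
  · rw [tm_even, tm_odd] at h
    rcases isDigits_tm j with h' | h' <;> rw [h'] at h <;> norm_num at h
  · refine ⟨?_, j, rfl⟩
    rw [h, show 2 * j + 1 + 2 = 2 * (j + 1) + 1 by ring, tm_odd,
      show 2 * j + 1 + 1 = 2 * (j + 1) by ring, tm_even]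

/-! ### Lexicographic bounds -/

/-- The tail of `a` after place `i`, reflected if `a i = 1`, agrees with `α` up to a first place
where it is smaller. -/
def LexLT (α a : ℕ → ℝ) (i : ℕ) : Prop :=
  ∃ j, (∀ l < j, a (i + 1 + l) = rxor (a i) (α l)) ∧ α j = 1 ∧ a (i + 1 + j) = a i

/-- The tail of `a` after place `i`, reflected if `a i = 1`, equals `α`. -/
def LexEq (α a : ℕ → ℝ) (i : ℕ) : Prop := ∀ l, a (i + 1 + l) = rxor (a i) (α l)

section Substitution

variable {a a' α α' : ℕ → ℝ}

/-- The hypotheses say that a is the image of a' under 0 ↦ 01, 1 ↦ 10, and that α is the digit 1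
followed by the image of α'. This relates τ₁τ₂… to itself and the periodic sequences of level k to
those of level k + 1, so lexicographic bounds at even places are inherited. -/
theorem subst_agree {i j : ℕ} (h0 : ∀ l, a (2 * l) = a' l) (h1 : ∀ l, a (2 * l + 1) = 1 - a' l)
    (hα : α 0 = 1) (hα1 : ∀ l, α (2 * l + 1) = α' l) (hα2 : ∀ l, α (2 * l + 2) = 1 - α' l)
    (h : ∀ l < j, a' (i + 1 + l) = rxor (a' i) (α' l)) :
    ∀ l < 2 * j + 1, a (2 * i + 1 + l) = rxor (a (2 * i)) (α l) := by
  intro l hl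
  rw [h0]
  rcases Nat.even_or_odd' l with ⟨m, rfl | rfl⟩
  · rcases m with _ | m
    · rw [mul_zero, add_zero, h1, hα, rxor_one_right]
    · rw [show 2 * i + 1 + 2 * (m + 1) = 2 * (i + 1 + m) + 1 by ring, h1,
        h m (by omega), show 2 * (m + 1) = 2 * m + 2 by ring, hα2, rxor_compl_right]
  · rw [show 2 * i + 1 + (2 * m + 1) = 2 * (i + 1 + m) by ring, h0, h m (by omega), hα1]

theorem LexLT.subst {i : ℕ} (h0 : ∀ l, a (2 * l) = a' l) (h1 : ∀ l, a (2 * l + 1) = 1 - a' l)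
    (hα : α 0 = 1) (hα1 : ∀ l, α (2 * l + 1) = α' l) (hα2 : ∀ l, α (2 * l + 2) = 1 - α' l)
    (h : LexLT α' a' i) : LexLT α a (2 * i) := by
  obtain ⟨j, hj, hj1, hj2⟩ := h
  refine ⟨2 * j + 1, subst_agree h0 h1 hα hα1 hα2 hj, by rw [hα1, hj1], ?_⟩
  rw [show 2 * i + 1 + (2 * j + 1) = 2 * (i + 1 + j) by ring, h0, h0, hj2]

theorem LexEq.subst {i : ℕ} (h0 : ∀ l, a (2 * l) = a' l) (h1 : ∀ l, a (2 * l + 1) = 1 - a' l)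
    (hα : α 0 = 1) (hα1 : ∀ l, α (2 * l + 1) = α' l) (hα2 : ∀ l, α (2 * l + 2) = 1 - α' l)
    (h : LexEq α' a' i) : LexEq α a (2 * i) := fun l =>
  subst_agree (j := l) h0 h1 hα hα1 hα2 (fun l _ => h l) l (by omega)

/-- After an odd place a new block 01 or 10 begins, so the reflected tail starts with 01 or 10 and
lies below any α starting with 11. -/
theorem lexLT_subst_odd {i : ℕ} (ha : IsDigits a') (h0 : ∀ l, a (2 * l) = a' l)
    (h1 : ∀ l, a (2 * l + 1) = 1 - a' l) (hα : α 0 = 1) (hα1 : α 1 = 1) :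
    LexLT α a (2 * i + 1) := by
  by_cases h : a (2 * i + 2) = a (2 * i + 1)
  · exact ⟨0, by simp, hα, h⟩
  · refine ⟨1, fun l hl => ?_, hα1, ?_⟩
    · obtain rfl : l = 0 := by omega
      rw [hα, rxor_one_right, h1, show 2 * i + 1 + 1 + 0 = 2 * (i + 1) by ring, h0]
      rw [h1, show 2 * i + 2 = 2 * (i + 1) by ring, h0] at h
      rcases ha i with h2 | h2 <;> rcases ha (i + 1) with h3 | h3 <;> simp_all
    · rw [show 2 * i + 1 + 1 + 1 = 2 * (i + 1) + 1 by ring, h1, h1]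
      rw [h1, show 2 * i + 2 = 2 * (i + 1) by ring, h0] at h
      rcases ha i with h2 | h2 <;> rcases ha (i + 1) with h3 | h3 <;> simp_all

end Substitution

theorem lexLT_tm {i : ℕ} (hi : 1 ≤ i) : LexLT (fun l => tm (1 + l)) tm i := by
  induction i using Nat.strong_induction_on with
  | _ i ih =>
    rcases Nat.even_or_odd' i with ⟨j, rfl | rfl⟩
    · refine LexLT.subst tm_even tm_odd tm_one (fun l => ?_) (fun l => ?_)
        (ih j (by omega) (by omega))
      · rw [show 1 + (2 * l + 1) = 2 * (1 + l) by ring, tm_even]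
      · rw [show 1 + (2 * l + 2) = 2 * (1 + l) + 1 by ring, tm_odd]
    · exact lexLT_subst_odd isDigits_tm tm_even tm_odd tm_one tm_two

/-- The value of the tail of `a` after place `i`, reflected if `a i = 1`. -/
noncomputable def reflTail (q : ℝ) (a : ℕ → ℝ) (i : ℕ) : ℝ :=
  rval q (fun l => rxor (a i) (a (i + 1 + l)))

theorem reflTail_zero {q : ℝ} {a : ℕ → ℝ} {i : ℕ} (h : a i = 0) :
    reflTail q a i = rval q (fun l => a (i + 1 + l)) := by
  simp only [reflTail, h, rxor_zero_left]

theorem reflTail_one {q : ℝ} (hq : 1 < q) {a : ℕ → ℝ} (ha : IsDigits a) {i : ℕ} (h : a i = 1) :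
    reflTail q a i = 1 / (q - 1) - rval q (fun l => a (i + 1 + l)) := by
  simp only [reflTail, h, rxor_one_left]
  exact rval_compl hq (ha.shift (i + 1))

theorem univoque_iff {q : ℝ} (hq : 1 < q) {a : ℕ → ℝ} (ha : IsDigits a) :
    Univoque q a ↔ ∀ i, reflTail q a i < 1 := by
  refine forall_congr' fun i => ?_
  rcases ha i with h | h
  · simp [reflTail_zero h, h]
  · simp [reflTail_one hq ha h, h]

theorem rxor_rxor {b : ℝ} (hb : b = 0 ∨ b = 1) (c : ℝ) : rxor b (rxor b c) = c := by
  rcases hb with rfl | rfl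
  · simp [rxor_zero_left]
  · simp [rxor_one_left]

theorem isDigits_rxor {a : ℕ → ℝ} (ha : IsDigits a) {b : ℝ} (hb : b = 0 ∨ b = 1) :
    IsDigits (fun l => rxor b (a l)) := by
  rcases hb with rfl | rfl
  · simpa [rxor_zero_left] using ha
  · simpa [rxor_one_left] using ha.compl

/-- At the first disagreement the digit equals `a i` again, so what follows is a reflected tail of
the same kind. This recursion turns lexicographic bounds into bounds on values. -/
theorem LexLT.reflTail {q : ℝ} (hq : 1 < q) {a α : ℕ → ℝ} (ha : IsDigits a)
    (hα : IsDigits α) {i : ℕ} (h : LexLT α a i) :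
    ∃ j, ThueMorseBases.reflTail q a i = rval q α +
      (ThueMorseBases.reflTail q a (i + 1 + j) - 1 - rval q (fun l => α (j + 1 + l)))
        / q ^ (j + 1) := by
  obtain ⟨j, hj, hj1, hj2⟩ := h
  refine ⟨j, ?_⟩
  have hd := isDigits_rxor (ha.shift (i + 1)) (ha i)
  unfold ThueMorseBases.reflTail
  rw [rval_split hq hd (j + 1), rval_split hq hα (j + 1), Finset.sum_range_succ,
    Finset.sum_range_succ, hj1, hj2,
    Finset.sum_congr rfl fun l hl => by rw [hj l (Finset.mem_range.mp hl), rxor_rxor (ha i)]]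
  have e : rxor (a i) (a i) = 0 := by
    rcases ha i with h | h <;> rw [h] <;> norm_num [rxor]
  rw [e]
  simp only [← add_assoc]
  have e2 : ∀ l, i + 1 + j + 1 + l = i + 1 + (j + 1) + l := fun l => by ring
  simp only [add_assoc]
  field_simp
  ring

theorem LexEq.reflTail {q : ℝ} {a α : ℕ → ℝ} (ha : IsDigits a) {i : ℕ} (h : LexEq α a i) :
    ThueMorseBases.reflTail q a i = rval q α := by
  refine rval_congr fun l => ?_
  rw [h l, rxor_rxor (ha i)]

/-- Lexicographic bounds by a sequence of value at most `1` bound the values of all tails. -/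
theorem reflTail_le_one {q : ℝ} (hq : 1 < q) {a α : ℕ → ℝ} (ha : IsDigits a)
    (hα : IsDigits α) (hv : rval q α ≤ 1) {i₀ : ℕ}
    (h : ∀ i ≥ i₀, LexLT α a i ∨ LexEq α a i) : ∀ i ≥ i₀, reflTail q a i ≤ 1 := by
  have hq1 : 0 < q - 1 := by linarith
  -- Each use of the recursion shrinks the excess over 1 at least by the factor q⁻¹, starting from
  -- the trivial bound 1/(q-1).
  have key : ∀ N : ℕ, ∀ i ≥ i₀, reflTail q a i - 1 ≤ 1 / (q - 1) * (q⁻¹) ^ N := by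
    intro N
    induction N with
    | zero =>
      intro i _
      have := rval_le hq (isDigits_rxor (ha.shift (i + 1)) (ha i))
      rw [pow_zero, mul_one]
      unfold reflTail
      linarith
    | succ N ih =>
      intro i hi
      rcases h i hi with h | h
      · obtain ⟨j, hj⟩ := h.reflTail hq ha hα
        have h1 := ih (i + 1 + j) (by omega)
        have h2 := rval_nonneg hq (hα.shift (j + 1))
        have h3 : (reflTail q a (i + 1 + j) - 1 - rval q (fun l => α (j + 1 + l))) / q ^ (j + 1)
            ≤ 1 / (q - 1) * (q⁻¹) ^ N / q ^ 1 := by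
          refine (div_le_div_of_nonneg_right (c := q ^ (j + 1)) (sub_le_self_iff _ |>.mpr h2 |>.trans h1)
            (by positivity)).trans ?_
          gcongr
          · exact hq.le
          · omega
        rw [pow_succ (q⁻¹), ← mul_assoc, ← div_eq_mul_inv]
        rw [pow_one] at h3
        linarith
      · rw [h.reflTail ha]
        have : 0 ≤ 1 / (q - 1) * (q⁻¹) ^ (N + 1) := by positivity
        linarith
  intro i hi
  have h3 : Tendsto (fun n : ℕ => (1 / (q - 1)) * (q⁻¹) ^ n) atTop (𝓝 0) := by
    simpa using (tendsto_pow_atTop_nhds_zero_of_lt_one (r := q⁻¹) (by positivity)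
      (inv_lt_one_of_one_lt₀ hq)).const_mul (1 / (q - 1))
  have := ge_of_tendsto' h3 (fun N => key N i hi)
  linarith

theorem reflTail_lt_one_of_lt {q : ℝ} (hq : 1 < q) {a α : ℕ → ℝ} (ha : IsDigits a)
    (hα : IsDigits α) (hv : rval q α < 1) {i₀ : ℕ}
    (h : ∀ i ≥ i₀, LexLT α a i ∨ LexEq α a i) : ∀ i ≥ i₀, reflTail q a i < 1 := by
  intro i hi
  rcases h i hi with h' | h'
  · obtain ⟨j, hj⟩ := h'.reflTail hq ha hα
    have h1 := reflTail_le_one hq ha hα hv.le h (i + 1 + j) (by omega)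
    have h2 := rval_nonneg hq (hα.shift (j + 1))
    have : (reflTail q a (i + 1 + j) - 1 - rval q (fun l => α (j + 1 + l))) / q ^ (j + 1) ≤ 0 :=
      div_nonpos_of_nonpos_of_nonneg (by linarith) (by positivity)
    linarith
  · rwa [h'.reflTail ha]

/-- Every tail of a sequence of `01`- and `10`-blocks has value less than `1` if reflected tails
do. -/
theorem tail_lt_one {q : ℝ} (hq : 1 < q) (hq1 : q + 1 < q ^ 2) {a : ℕ → ℝ} (ha : IsDigits a)
    {i₀ : ℕ} (h : ∀ i ≥ i₀, reflTail q a i < 1) (hp : ∀ l, a (2 * l + 1) = 1 - a (2 * l)) {i : ℕ}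
    (hi : i₀ ≤ i) (h0 : i = i₀ → a i = 0 ∨ a (i + 1) = 0) : rval q (fun l => a (i + l)) < 1 := by
  have hq0 : 0 < q := by linarith
  have hz : ∀ j ≥ i₀, a j = 0 → rval q (fun l => a (j + l)) < 1 / q := by
    intro j hj hj0
    rw [rval_shift_cons hq ha, hj0, zero_add]
    have := h j hj
    rw [reflTail_zero hj0] at this
    gcongr
  have hq2 : 1 / q < 1 := by
    rw [div_lt_one hq0]
    exact hq
  by_cases hi0 : a i = 0
  · exact (hz i hi hi0).trans hq2
  have hi1 : a i = 1 := (ha i).resolve_left hi0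
  by_cases hj0 : a (i + 1) = 0
  · rw [rval_shift_cons hq ha, hi1]
    have := hz (i + 1) (by omega) hj0
    rw [div_lt_one hq0]
    have h3 : 1 / q < q - 1 := by
      rw [div_lt_iff₀ hq0]
      nlinarith
    linarith
  -- A tail beginning with 11 must start at an odd place, inside a block 01; hence it follows a
  -- digit 0 and the hypothesis on reflected tails applies. At i = i₀ that preceding digit may be
  -- out of range, which is why 11 is excluded there.
  have hj1 : a (i + 1) = 1 := (ha (i + 1)).resolve_left hj0
  have hne : i ≠ i₀ := fun e => by
    rcases h0 e with h | h
    · exact hi0 h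
    · exact hj0 h
  rcases Nat.even_or_odd' i with ⟨j, rfl | rfl⟩
  · have := hp j
    rw [hi1, hj1] at this
    norm_num at this
  · have hj : a (2 * j) = 0 := by
      have := hp j
      linarith
    have := h (2 * j) (by omega)
    rwa [reflTail_zero hj] at this

/-! ### Values at the Komornik–Loreti constant -/

theorem one_lt_qKL : 1 < qKL := qKL_spec.1

theorem rval_tm_qKL : rval qKL (fun l => tm (1 + l)) = 1 := by
  rw [← qKL_spec.2.2]
  refine tsum_congr fun i => ?_
  simp [tm, toReal, add_comm]

/-- The value of `τₙτₙ₊₁…` in the Komornik–Loreti base. -/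
noncomputable def tmValue (n : ℕ) : ℝ := rval qKL (fun l => tm (n + l))

theorem tmValue_one : tmValue 1 = 1 := rval_tm_qKL

theorem tmValue_eq (n : ℕ) : tmValue n = (tm n + tmValue (n + 1)) / qKL :=
  rval_shift_cons one_lt_qKL isDigits_tm n

theorem exists_tm_one (n : ℕ) : ∃ i, tm (n + i) = 1 := by
  rcases isDigits_tm n with h | h
  · by_cases h1 : tm (n + 1) = 1
    · exact ⟨1, h1⟩
    · have h0 := (isDigits_tm (n + 1)).resolve_right h1
      have := (tm_no_cube (h.trans h0.symm)).1
      exact ⟨2, by rw [this, h, sub_zero]⟩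
  · exact ⟨0, h⟩

theorem tmValue_pos (n : ℕ) : 0 < tmValue n := by
  obtain ⟨i, hi⟩ := exists_tm_one n
  exact rval_pos one_lt_qKL (isDigits_tm.shift n) (i := i) hi

theorem sum_le_rval {q : ℝ} (hq : 1 < q) {a : ℕ → ℝ} (ha : IsDigits a) (N : ℕ) :
    ∑ i ∈ Finset.range N, a i / q ^ (i + 1) ≤ rval q a := by
  rw [rval_split hq ha N]
  have := rval_nonneg hq (ha.shift N)
  have : 0 ≤ rval q (fun l => a (N + l)) / q ^ N := by positivity
  linarith

theorem tm_eight_to_fifteen : tm 8 = 1 ∧ tm 9 = 0 ∧ tm 10 = 0 ∧ tm 11 = 1 ∧ tm 12 = 0 ∧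
    tm 13 = 1 ∧ tm 14 = 1 ∧ tm 15 = 0 :=
  ⟨by simpa [tm_four] using tm_even 4, by simpa [tm_four] using tm_odd 4,
    by simpa [tm_five] using tm_even 5, by simpa [tm_five] using tm_odd 5,
    by simpa [tm_six] using tm_even 6, by simpa [tm_six] using tm_odd 6,
    by simpa [tm_seven] using tm_even 7, by simpa [tm_seven] using tm_odd 7⟩

theorem qKL_gt : 1.787 < qKL := by
  by_contra hle
  have hle : qKL ≤ 1.787 := not_lt.mp hle
  have h1 := rval_anti one_lt_qKL hle (isDigits_tm.shift 1)
  rw [rval_tm_qKL] at h1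
  have h2 := sum_le_rval (q := 1.787) (by norm_num) (isDigits_tm.shift 1) 14
  obtain ⟨h8, h9, h10, h11, h12, h13, h14, h15⟩ := tm_eight_to_fifteen
  simp only [Finset.sum_range_succ, Finset.sum_range_zero] at h2
  norm_num [tm_one, tm_two, tm_three, tm_four, tm_five, tm_six, tm_seven, h8, h9, h10, h11, h12,
    h13, h14] at h2
  linarith

theorem qKL_lt : qKL < 1.7873 := by
  by_contra hle
  have hle : 1.7873 ≤ qKL := not_lt.mp hle
  have h1 := rval_anti (by norm_num) hle (isDigits_tm.shift 1)
  rw [rval_tm_qKL] at h1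
  rw [rval_split (by norm_num) (isDigits_tm.shift 1) 17] at h1
  have h2 := rval_le (q := 1.7873) (by norm_num) ((isDigits_tm.shift 1).shift 17)
  have h3 : rval 1.7873 (fun l => tm (1 + (17 + l))) / 1.7873 ^ 17 ≤
    1 / (1.7873 - 1) / 1.7873 ^ 17 := by gcongr
  obtain ⟨h8, h9, h10, h11, h12, h13, h14, h15⟩ := tm_eight_to_fifteen
  have h16 : tm 16 = 1 := tm_pow 4
  have h17 : tm 17 = 0 := by simpa [h8] using tm_odd 8
  simp only [Finset.sum_range_succ, Finset.sum_range_zero] at h1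
  norm_num [tm_one, tm_two, tm_three, tm_four, tm_five, tm_six, tm_seven, h8, h9, h10, h11, h12,
    h13, h14, h15, h16, h17] at h1 h3
  linarith

/-- Although τ₁τ₂… has value exactly 1, the inequality is strict because the part of it behind the
first disagreement is positive. -/
theorem reflTail_tm_lt {i : ℕ} (hi : 1 ≤ i) : reflTail qKL tm i < 1 := by
  have hα := isDigits_tm.shift 1
  obtain ⟨j, hj⟩ := (lexLT_tm hi).reflTail one_lt_qKL isDigits_tm hα
  have h1 := reflTail_le_one one_lt_qKL isDigits_tm hα rval_tm_qKL.le
    (fun i (hi : 1 ≤ i) => Or.inl (lexLT_tm hi)) (i + 1 + j) (by omega)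
  have h2 : 0 < rval qKL (fun l => tm (1 + (j + 1 + l))) := by
    have := tmValue_pos (1 + (j + 1))
    unfold tmValue at this
    simpa only [add_assoc] using this
  rw [rval_tm_qKL] at hj
  have h0 := one_lt_qKL
  have : (reflTail qKL tm (i + 1 + j) - 1 - rval qKL (fun l => tm (1 + (j + 1 + l)))) /
      qKL ^ (j + 1) < 0 := div_neg_of_neg_of_pos (by linarith) (by positivity)
  linarith

theorem tmValue_succ_lt {i : ℕ} (hi : 1 ≤ i) (h : tm i = 0) : tmValue (i + 1) < 1 := by
  have := reflTail_tm_lt hi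
  rwa [reflTail_zero h] at this

theorem lt_tmValue_succ {i : ℕ} (hi : 1 ≤ i) (h : tm i = 1) :
    1 / (qKL - 1) - 1 < tmValue (i + 1) := by
  have := reflTail_tm_lt hi
  rw [reflTail_one one_lt_qKL isDigits_tm h] at this
  unfold tmValue
  linarith

theorem add_one_lt_sq {q : ℝ} (h : 1.6181 ≤ q) : q + 1 < q ^ 2 := by nlinarith

theorem tmValue_lt_one {n : ℕ} (hn : 2 ≤ n) : tmValue n < 1 := by
  refine tail_lt_one one_lt_qKL (add_one_lt_sq (by linarith [qKL_gt])) isDigits_tm (i₀ := 2)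
    (fun i hi => reflTail_tm_lt (by omega)) (fun l => by rw [tm_even, tm_odd]) hn ?_
  rintro rfl
  exact Or.inr tm_three

theorem tmValue_le_one {n : ℕ} (hn : 1 ≤ n) : tmValue n ≤ 1 := by
  rcases hn.lt_or_eq with h | rfl
  · exact (tmValue_lt_one h).le
  · exact tmValue_one.le

/-! ### The sequences with periodic ends -/

/-- The periodic repetition of the Thue–Morse block of length `2 ^ k`. -/
noncomputable def periodic (k i : ℕ) : ℝ := tm (i % 2 ^ k)

/-- The reflected Thue–Morse block of length `2 ^ k`, followed by the periodic repetition of the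
block. -/
noncomputable def flipped (k i : ℕ) : ℝ := if i < 2 ^ k then 1 - tm i else periodic k i

theorem isDigits_periodic (k : ℕ) : IsDigits (periodic k) := fun _ => isDigits_tm _

theorem isDigits_flipped (k : ℕ) : IsDigits (flipped k) := by
  intro i
  unfold flipped
  split_ifs
  · exact isDigits_tm.compl i
  · exact isDigits_periodic k i

theorem periodic_add (k i : ℕ) : periodic k (2 ^ k + i) = periodic k i := by
  simp [periodic]

theorem periodic_of_lt {k i : ℕ} (h : i < 2 ^ k) : periodic k i = tm i := by
  rw [periodic, Nat.mod_eq_of_lt h]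

theorem periodic_even (k i : ℕ) : periodic (k + 1) (2 * i) = periodic k i := by
  rw [periodic, pow_succ', Nat.mul_mod_mul_left, tm_even, periodic]

theorem periodic_odd (k i : ℕ) : periodic (k + 1) (2 * i + 1) = 1 - periodic k i := by
  have : (2 * i + 1) % 2 ^ (k + 1) = 2 * (i % 2 ^ k) + 1 := by
    rw [pow_succ', Nat.mod_mul, show (2 * i + 1) / 2 = i by omega]
    omega
  rw [periodic, this, tm_odd, periodic]

theorem flipped_even (k i : ℕ) : flipped (k + 1) (2 * i) = flipped k i := by
  unfold flipped
  rw [periodic_even, tm_even]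
  have : 2 * i < 2 ^ (k + 1) ↔ i < 2 ^ k := by rw [pow_succ']; omega
  simp only [this]

theorem flipped_odd (k i : ℕ) : flipped (k + 1) (2 * i + 1) = 1 - flipped k i := by
  unfold flipped
  rw [periodic_odd, tm_odd]
  have : 2 * i + 1 < 2 ^ (k + 1) ↔ i < 2 ^ k := by rw [pow_succ']; omega
  simp only [this]
  split_ifs <;> rfl

theorem flipped_add (k i : ℕ) : flipped k (2 ^ k + i) = periodic k i := by
  unfold flipped
  rw [if_neg (by omega), periodic_add]

theorem periodic_one_even (i : ℕ) : periodic 1 (2 * i) = 0 := by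
  rw [periodic, pow_one, Nat.mul_mod_right, tm_zero]

theorem periodic_one_odd (i : ℕ) : periodic 1 (2 * i + 1) = 1 := by
  rw [periodic, pow_one, show (2 * i + 1) % 2 = 1 by omega, tm_one]

theorem periodic_one_succ (i : ℕ) : periodic 1 (i + 1) = 1 - periodic 1 i := by
  rcases Nat.even_or_odd' i with ⟨j, rfl | rfl⟩
  · rw [periodic_one_even, periodic_one_odd, sub_zero]
  · rw [show 2 * j + 1 + 1 = 2 * (j + 1) by ring, periodic_one_even, periodic_one_odd, sub_self]

theorem lexEq_periodic_one (i : ℕ) : LexEq (fun l => periodic 1 (1 + l)) (periodic 1) i := by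
  intro l
  change periodic 1 (i + 1 + l) = rxor (periodic 1 i) (periodic 1 (1 + l))
  induction l with
  | zero => rw [add_zero, add_zero, periodic_one_succ, show 1 = 2 * 0 + 1 by rfl,
      periodic_one_odd, rxor_one_right]
  | succ l ih =>
    rw [← add_assoc, periodic_one_succ, ih, ← add_assoc 1 l 1, periodic_one_succ (1 + l),
      rxor_compl_right]

theorem periodic_subst_odd (k l : ℕ) :
    periodic (k + 1) (1 + (2 * l + 1)) = periodic k (1 + l) := by
  rw [show 1 + (2 * l + 1) = 2 * (1 + l) by ring, periodic_even]

theorem periodic_subst_even (k l : ℕ) :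
    periodic (k + 1) (1 + (2 * l + 2)) = 1 - periodic k (1 + l) := by
  rw [show 1 + (2 * l + 2) = 2 * (1 + l) + 1 by ring, periodic_odd]

theorem periodic_at_one (k : ℕ) : periodic (k + 1) 1 = 1 := by
  rw [periodic_of_lt (Nat.one_lt_two_pow (by omega)), tm_one]

theorem periodic_at_two (k : ℕ) : periodic (k + 2) 2 = 1 := by
  have := periodic_even (k + 1) 1
  rwa [periodic_at_one] at this

/-- The alternating sequence attains equality everywhere, and the substitution 0 ↦ 01, 1 ↦ 10 raises
the level. -/
theorem lexLE_periodic (k : ℕ) : ∀ i, LexLT (fun l => periodic (k + 1) (1 + l))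
    (periodic (k + 1)) i ∨ LexEq (fun l => periodic (k + 1) (1 + l)) (periodic (k + 1)) i := by
  induction k with
  | zero => exact fun i => Or.inr (lexEq_periodic_one i)
  | succ k ih =>
    intro i
    rcases Nat.even_or_odd' i with ⟨j, rfl | rfl⟩
    · refine (ih j).imp (fun h => ?_) (fun h => ?_)
      · exact h.subst (periodic_even _) (periodic_odd _) (periodic_at_one _)
          (periodic_subst_odd _) (periodic_subst_even _)
      · exact h.subst (periodic_even _) (periodic_odd _) (periodic_at_one _)
          (periodic_subst_odd _) (periodic_subst_even _)
    · exact Or.inl (lexLT_subst_odd (isDigits_periodic (k + 1)) (periodic_even _)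
        (periodic_odd _) (periodic_at_one _) (periodic_at_two _))

theorem flipped_one_of_two_le {i : ℕ} (h : 2 ≤ i) : flipped 1 i = periodic 1 i := by
  rw [flipped, if_neg (by omega)]

/-- Place 0 has to be left out: the reflected tail after it follows the bound up to the end of the
block and then has 1 in place of 0. -/
theorem lexLE_flipped (k : ℕ) : ∀ i ≥ 1, LexLT (fun l => periodic (k + 1) (1 + l))
    (flipped (k + 1)) i ∨ LexEq (fun l => periodic (k + 1) (1 + l)) (flipped (k + 1)) i := by
  induction k with
  | zero =>
    intro i hi
    rcases hi.lt_or_eq with h | rfl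
    · refine Or.inr fun l => ?_
      rw [zero_add, flipped_one_of_two_le (by omega), flipped_one_of_two_le (by omega)]
      exact lexEq_periodic_one i l
    · refine Or.inl ⟨0, by simp, periodic_at_one _, ?_⟩
      have h1 : flipped (0 + 1) 1 = 0 := by simp [flipped, tm_one]
      rw [h1, zero_add, flipped_one_of_two_le (by omega)]
      exact periodic_one_even 1
  | succ k ih =>
    intro i hi
    rcases Nat.even_or_odd' i with ⟨j, rfl | rfl⟩
    · refine (ih j (by omega)).imp (fun h => ?_) (fun h => ?_)
      · exact h.subst (flipped_even _) (flipped_odd _) (periodic_at_one _)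
          (periodic_subst_odd _) (periodic_subst_even _)
      · exact h.subst (flipped_even _) (flipped_odd _) (periodic_at_one _)
          (periodic_subst_odd _) (periodic_subst_even _)
    · exact Or.inl (lexLT_subst_odd (isDigits_flipped (k + 1)) (flipped_even _)
        (flipped_odd _) (periodic_at_one _) (periodic_at_two _))

/-- The truncation `∑ τᵢ / qⁱ`, `1 ≤ i ≤ 2 ^ k`. -/
noncomputable def trunc (k : ℕ) (q : ℝ) : ℝ :=
  ∑ i ∈ Finset.range (2 ^ k), tm (1 + i) / q ^ (i + 1)

/-- The period read from index 1 is τ₁…τ_{2^k} with its last digit lowered from 1 to 0, so the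
infinite and the truncated sequence lie on the same side of 1. -/
theorem rval_periodic {q : ℝ} (hq : 1 < q) (k : ℕ) :
    (rval q (fun l => periodic k (1 + l)) - 1) * (1 - 1 / q ^ 2 ^ k) = trunc k q - 1 := by
  have hd := (isDigits_periodic k).shift 1
  have h := rval_split hq hd (2 ^ k)
  have e : rval q (fun l => periodic k (1 + (2 ^ k + l))) =
      rval q (fun l => periodic k (1 + l)) := by
    refine rval_congr fun l => ?_
    rw [← add_assoc, add_comm 1, add_assoc, periodic_add]
  have hs : ∑ i ∈ Finset.range (2 ^ k), periodic k (1 + i) / q ^ (i + 1) =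
      trunc k q - 1 / q ^ 2 ^ k := by
    obtain ⟨B, hB⟩ : ∃ B, 2 ^ k = B + 1 := ⟨2 ^ k - 1, by have := Nat.two_pow_pos k; omega⟩
    rw [trunc, hB, Finset.sum_range_succ, Finset.sum_range_succ, ← hB]
    have h1 : periodic k (1 + B) = 0 := by
      rw [periodic, show 1 + B = 2 ^ k by omega, Nat.mod_self, tm_zero]
    have h2 : tm (1 + B) = 1 := by rw [show 1 + B = 2 ^ k by omega, tm_pow]
    rw [h1, h2, Finset.sum_congr rfl fun i hi => by
      rw [periodic_of_lt (by have := Finset.mem_range.mp hi; omega)]]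
    ring
  rw [e, hs] at h
  have h0 : q ^ 2 ^ k ≠ 0 := by positivity
  field_simp at h ⊢
  linarith

theorem inv_pow_two_pow_lt_one {q : ℝ} (hq : 1 < q) (k : ℕ) : 0 < 1 - 1 / q ^ 2 ^ k := by
  have : 1 < q ^ 2 ^ k := one_lt_pow₀ hq (by positivity)
  rw [sub_pos, div_lt_one (by linarith)]
  exact this

theorem rval_periodic_lt_one {q : ℝ} (hq : 1 < q) {k : ℕ} (h : trunc k q < 1) :
    rval q (fun l => periodic k (1 + l)) < 1 := by
  have h1 := rval_periodic hq k
  have h2 := inv_pow_two_pow_lt_one hq k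
  by_contra hge
  have : 0 ≤ (rval q (fun l => periodic k (1 + l)) - 1) * (1 - 1 / q ^ 2 ^ k) :=
    mul_nonneg (by linarith) h2.le
  linarith

theorem rval_periodic_eq_one {q : ℝ} (hq : 1 < q) {k : ℕ} (h : trunc k q = 1) :
    rval q (fun l => periodic k (1 + l)) = 1 := by
  have h1 := rval_periodic hq k
  have h2 := inv_pow_two_pow_lt_one hq k
  rw [h, sub_self] at h1
  rcases mul_eq_zero.mp h1 with h | h
  · linarith
  · exact absurd h h2.ne'

theorem trunc_strictAnti {p q : ℝ} (hp : 1 < p) (hpq : p < q) (k : ℕ) :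
    trunc k q < trunc k p := by
  refine Finset.sum_lt_sum (fun i _ => ?_) ⟨0, by simp, ?_⟩
  · have := isDigits_tm.nonneg (1 + i)
    gcongr
  · rw [add_zero, tm_one]
    gcongr

theorem trunc_mono_index {q : ℝ} (hq : 1 < q) {k l : ℕ} (h : k ≤ l) : trunc k q ≤ trunc l q := by
  refine Finset.sum_le_sum_of_subset_of_nonneg (Finset.range_subset_range.mpr
    (Nat.pow_le_pow_right two_pos h)) fun i _ _ => ?_
  have := isDigits_tm.nonneg (1 + i)
  positivity

theorem trunc_one (q : ℝ) : trunc 1 q = 1 / q + 1 / q ^ 2 := by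
  simp [trunc, Finset.sum_range_succ, tm_one, tm_two]

theorem trunc_two (q : ℝ) : trunc 2 q = 1 / q + 1 / q ^ 2 + 1 / q ^ 4 := by
  simp [trunc, Finset.sum_range_succ, tm_one, tm_two, tm_three, tm_four]

theorem trunc_qKL (k : ℕ) : trunc k qKL = 1 - tmValue (2 ^ k + 1) / qKL ^ 2 ^ k := by
  have := rval_split one_lt_qKL (isDigits_tm.shift 1) (2 ^ k)
  rw [rval_tm_qKL] at this
  have e : tmValue (2 ^ k + 1) = rval qKL (fun l => tm (1 + (2 ^ k + l))) := by
    unfold tmValue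
    refine rval_congr fun l => ?_
    congr 1
    ring
  rw [e]
  unfold trunc
  linarith

theorem trunc_qKL_lt (k : ℕ) : trunc k qKL < 1 := by
  rw [trunc_qKL]
  have := tmValue_pos (2 ^ k + 1)
  have := one_lt_qKL
  have : 0 < tmValue (2 ^ k + 1) / qKL ^ 2 ^ k := by positivity
  linarith

theorem continuousOn_trunc {p r : ℝ} (hp : 1 < p) (k : ℕ) :
    ContinuousOn (trunc k) (Set.Icc p r) := by
  refine continuousOn_finsetSum _ fun i _ => ContinuousOn.div continuousOn_const (by fun_prop)
    fun q hq => ?_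
  have : 0 < q := by linarith [hq.1]
  positivity

/-- The base in which the Thue–Morse sequence truncated at `2 ^ k` has value `1`. -/
theorem exists_base {k : ℕ} (hk : 1 ≤ k) :
    ∃ p, 1.618 ≤ p ∧ p < qKL ∧ trunc k p = 1 := by
  have h1 : 1 ≤ trunc k 1.618 := by
    refine le_trans ?_ (trunc_mono_index (by norm_num) hk)
    rw [trunc_one]
    norm_num
  obtain ⟨p, hp, hp1⟩ := intermediate_value_Icc' (f := trunc k) (by linarith [qKL_gt])
    (continuousOn_trunc (by norm_num) k) ⟨(trunc_qKL_lt k).le, h1⟩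
  refine ⟨p, hp.1, lt_of_le_of_ne hp.2 ?_, hp1⟩
  rintro rfl
  exact (trunc_qKL_lt k).ne hp1

theorem lt_of_trunc_lt {p q : ℝ} {k : ℕ} (hq : 1 < q) (hp : trunc k p = 1) (h : trunc k q < 1) :
    p < q := by
  by_contra hle
  rcases (not_lt.mp hle).lt_or_eq with h1 | h1
  · have := trunc_strictAnti hq h1 k
    linarith
  · rw [h1, hp] at h
    exact lt_irrefl _ h

theorem trunc_lt_of_lt {p q : ℝ} {k : ℕ} (hp1 : 1 < p) (hp : trunc k p = 1) (h : p < q) :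
    trunc k q < 1 := hp ▸ trunc_strictAnti hp1 h k

/-! ### The index set -/

/-- The block of length `2 ^ k` starting at the first multiple of `2 ^ k` not below `n` is the
reflected one, for every `k ≥ 1`. -/
def BlocksReflected (n : ℕ) : Prop :=
  ∀ k ≥ 1, ∀ b j, n = 2 ^ k * b + j → 1 ≤ j → j ≤ 2 ^ k → tm (b + 1) = 1

/-- If `n` is the second index of a block of length `2 ^ k`, `k ≥ 1`, then this block is the
reflected one. -/
def StartsReflected (n : ℕ) : Prop := ∀ k ≥ 1, ∀ a, n = 2 ^ k * a + 1 → tm a = 1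

theorem tm_of_one_le_of_le_two {n : ℕ} (h1 : 1 ≤ n) (h2 : n ≤ 2) : tm n = 1 := by
  obtain rfl | rfl : n = 1 ∨ n = 2 := by omega
  · exact tm_one
  · exact tm_two

theorem conditions_of_le_four {n : ℕ} (h2 : 2 ≤ n) (h4 : n ≤ 4) :
    BlocksReflected n ∧ StartsReflected n := by
  constructor
  · intro k hk b j h hj hj2
    have hk2 : 2 ^ 1 ≤ 2 ^ k := Nat.pow_le_pow_right two_pos hk
    refine tm_of_one_le_of_le_two (by omega) ?_
    by_contra hb
    have : 2 ^ k * 2 ≤ 2 ^ k * b := Nat.mul_le_mul_left _ (by omega)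
    omega
  · intro k hk a h
    have hk2 : 2 ^ 1 ≤ 2 ^ k := Nat.pow_le_pow_right two_pos hk
    have ha : a ≠ 0 := by
      rintro rfl
      omega
    have : a = 1 := by
      by_contra hb
      have : 2 ^ k * 2 ≤ 2 ^ k * a := Nat.mul_le_mul_left _ (by omega)
      omega
    rw [this, tm_one]

theorem tm_three_blocks {r c : ℕ} (h1 : c ≤ 2 ^ r) (h0 : 1 ≤ c) :
    tm (3 * 2 ^ r + c) = tm c := by
  rcases h1.lt_or_eq with h | rfl
  · rw [mul_comm, tm_block_zero h tm_three]
  · rw [show 3 * 2 ^ r + 2 ^ r = 2 ^ r * 4 by ring, tm_pow_mul, tm_pow, tm_four]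

/-- The shift by 3 · 2^(K-1) is the one in the recursion for `S`. For blocks of length up to 2^(K-1)
it does not change the digits involved (`tm_three_blocks`: τ₃ = 0, and τ₄ = 1 at the far end); for
longer blocks both conditions only concern τ₁ and τ₂. -/
theorem conditions_step {K n : ℕ} (hK : 2 ≤ K) (hhi : n ≤ 2 ^ (K - 1)) (hn : 2 ≤ n) :
    (BlocksReflected (n + 3 * 2 ^ (K - 1)) ∧ StartsReflected (n + 3 * 2 ^ (K - 1))) ↔
      BlocksReflected n ∧ StartsReflected n := by
  obtain ⟨L, rfl⟩ : ∃ L, K = L + 1 := ⟨K - 1, by omega⟩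
  rw [Nat.add_sub_cancel] at *
  have small : ∀ k b j, k > L → n + 3 * 2 ^ L = 2 ^ k * b + j → 1 ≤ j → b ≤ 1 := by
    intro k b j hk h hj
    by_contra hb
    have h1 : 2 ^ k * 2 ≤ 2 ^ k * b := Nat.mul_le_mul_left _ (by omega)
    have h2 : 2 ^ (L + 1) ≤ 2 ^ k := Nat.pow_le_pow_right two_pos hk
    rw [pow_succ] at h2
    omega
  have split : ∀ k ≤ L, ∃ r, 3 * 2 ^ L = 2 ^ k * (3 * 2 ^ r) ∧ 2 ^ L = 2 ^ k * 2 ^ r := by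
    intro k hk
    refine ⟨L - k, ?_, ?_⟩
    · rw [mul_left_comm, ← pow_add, Nat.add_sub_cancel' hk]
    · rw [← pow_add, Nat.add_sub_cancel' hk]
  have bound : ∀ k r b j, 2 ^ L = 2 ^ k * 2 ^ r → n = 2 ^ k * b + j → 1 ≤ j → b < 2 ^ r := by
    intro k r b j hr h hj
    have : 2 ^ k * b < 2 ^ k * 2 ^ r := by omega
    exact lt_of_mul_lt_mul_left this (Nat.zero_le _)
  have lower : ∀ k ≤ L, ∀ b j, n + 3 * 2 ^ L = 2 ^ k * b + j → j ≤ 2 ^ k → 1 ≤ j →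
      ∃ r c, b = 3 * 2 ^ r + c ∧ n = 2 ^ k * c + j ∧ c < 2 ^ r := by
    intro k hk b j h hj hj1
    obtain ⟨r, hr, hr2⟩ := split k hk
    have hb : 3 * 2 ^ r ≤ b := by
      by_contra hb
      have : 2 ^ k * (b + 1) ≤ 2 ^ k * (3 * 2 ^ r) := Nat.mul_le_mul_left _ (by omega)
      rw [mul_add] at this
      omega
    obtain ⟨c, rfl⟩ := Nat.exists_eq_add_of_le hb
    have hc : n = 2 ^ k * c + j := by
      rw [mul_add] at h
      omega
    exact ⟨r, c, rfl, hc, bound k r c j hr2 hc hj1⟩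
  constructor
  · rintro ⟨h1, h2⟩
    constructor
    · intro k hk b j h hj hj2
      rcases le_or_gt k L with hkL | hkL
      · obtain ⟨r, hr, hr2⟩ := split k hkL
        have := h1 k hk (3 * 2 ^ r + b) j (by rw [mul_add, hr]; omega) hj hj2
        rwa [add_assoc, tm_three_blocks (bound k r b j hr2 h hj) (by omega)] at this
      · have h3 : 2 ^ L < 2 ^ k := Nat.pow_lt_pow_right (by norm_num) hkL
        have : b = 0 := by
          by_contra hb
          have : 2 ^ k * 1 ≤ 2 ^ k * b := Nat.mul_le_mul_left _ (by omega)
          omega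
        rw [this, zero_add, tm_one]
    · intro k hk a h
      have ha : 1 ≤ a := by
        rcases Nat.eq_zero_or_pos a with rfl | ha
        · omega
        · exact ha
      rcases le_or_gt k L with hkL | hkL
      · obtain ⟨r, hr, hr2⟩ := split k hkL
        have := h2 k hk (3 * 2 ^ r + a) (by rw [mul_add, hr]; omega)
        rwa [tm_three_blocks (bound k r a 1 hr2 h le_rfl).le ha] at this
      · have h3 : 2 ^ L < 2 ^ k := Nat.pow_lt_pow_right (by norm_num) hkL
        have : 2 ^ k * 1 ≤ 2 ^ k * a := Nat.mul_le_mul_left _ (by omega)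
        omega
  · rintro ⟨h1, h2⟩
    constructor
    · intro k hk b j h hj hj2
      rcases le_or_gt k L with hkL | hkL
      · obtain ⟨r, c, rfl, hc, hcr⟩ := lower k hkL b j h hj2 hj
        rw [add_assoc, tm_three_blocks hcr (by omega)]
        exact h1 k hk c j hc hj hj2
      · have := small k b j hkL h hj
        exact tm_of_one_le_of_le_two (by omega) (by omega)
    · intro k hk a h
      rcases le_or_gt k L with hkL | hkL
      · obtain ⟨r, c, rfl, hc, hcr⟩ := lower k hkL a 1 h (Nat.one_le_two_pow) le_rfl
        have hc1 : 1 ≤ c := by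
          rcases Nat.eq_zero_or_pos c with rfl | h
          · omega
          · exact h
        rw [tm_three_blocks hcr.le hc1]
        exact h2 k hk c hc
      · have := small k a 1 hkL h le_rfl
        have : a ≠ 0 := by
          rintro rfl
          omega
        obtain rfl : a = 1 := by omega
        exact tm_one

theorem exists_two_pow {n : ℕ} (hn : 4 < n) : ∃ K, 2 ≤ K ∧ 2 ^ K < n ∧ n ≤ 2 ^ (K + 1) := by
  refine ⟨Nat.log 2 (n - 1), ?_, ?_, ?_⟩
  · exact (Nat.le_log_iff_pow_le (by norm_num) (by omega)).mpr (by omega)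
  · have := Nat.pow_log_le_self 2 (x := n - 1) (by omega)
    omega
  · have := Nat.lt_pow_succ_log_self (b := 2) (by norm_num) (n - 1)
    omega

theorem one_not_mem_S : 1 ∉ S := by
  intro h
  cases (show MemS 1 from h) with
  | step k _ hk hlo hhi h hmem =>
    have := Nat.two_pow_pos (k - 1)
    omega

theorem mem_S_iff_conditions {n : ℕ} (hn : 2 ≤ n) :
    n ∈ S ↔ BlocksReflected n ∧ StartsReflected n := by
  induction n using Nat.strong_induction_on with
  | _ n ih =>
    rcases le_or_gt n 4 with h4 | h4
    · refine iff_of_true ?_ (conditions_of_le_four hn h4)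
      obtain rfl | rfl | rfl : n = 2 ∨ n = 3 ∨ n = 4 := by omega
      · exact MemS.two
      · exact MemS.three
      · exact MemS.four
    · obtain ⟨K, hK, hlo, hhi⟩ := exists_two_pow h4
      rw [mem_S_iff hK hlo hhi]
      obtain ⟨L, rfl⟩ : ∃ L, K = L + 1 := ⟨K - 1, by omega⟩
      have e : 2 ^ (L + 1) = 2 * 2 ^ L := pow_succ' 2 L
      have e2 : 2 ^ (L + 1 + 1) = 4 * 2 ^ L := by rw [pow_succ, e]; ring
      have hL := Nat.two_pow_pos L
      rw [Nat.add_sub_cancel]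
      by_cases hlt : 3 * 2 ^ L < n
      · obtain ⟨m, rfl⟩ : ∃ m, n = m + 3 * 2 ^ L := ⟨n - 3 * 2 ^ L, by omega⟩
        rw [Nat.add_sub_cancel]
        rcases Nat.lt_or_ge m 2 with hm | hm
        · obtain rfl : m = 1 := by omega
          refine iff_of_false ?_ ?_
          · exact fun h => one_not_mem_S h.2
          -- Here n = 3 · 2^L + 1 is the second index of block number 3, which is not reflected.
          · rintro ⟨_, h⟩
            have := h L (by omega) 3 (by ring)
            rw [tm_three] at this
            norm_num at this
        · have hst := conditions_step (K := L + 1) hK (n := m)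
            (by rw [Nat.add_sub_cancel]; omega) hm
          rw [Nat.add_sub_cancel] at hst
          rw [hst, ih m (by omega) hm]
          exact ⟨fun h => h.2, fun h => ⟨by omega, h⟩⟩
      · refine iff_of_false (fun h => hlt h.1) ?_
        rintro ⟨h, _⟩
        -- For 2^(L+1) < n ≤ 3 · 2^L the next block of length 2^L is again block number 3.
        have := h L (by omega) 2 (n - 2 ^ L * 2) (by omega) (by omega) (by omega)
        rw [tm_three] at this
        norm_num at this

theorem two_le_of_mem_S {n : ℕ} (h : n ∈ S) : 2 ≤ n := by
  cases (show MemS n from h) with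
  | two => omega
  | three => omega
  | four => omega
  | step k _ hk hlo hhi h hmem =>
    have := Nat.two_pow_pos (k - 1)
    omega

/-! ### Small univoque bases -/

theorem exists_univoque_lt {p x : ℝ} {a : ℕ → ℝ} (hp : 1 < p) (hpq : p < qKL) (ha : IsDigits a)
    (hu : ∀ q, p < q → q ≤ qKL → Univoque q a) (h1 : x < rval p a) (h2 : rval qKL a < x) :
    ∃ q ∈ univoqueBases x, q < qKL := by
  obtain ⟨q, hq, hqx⟩ := intermediate_value_Icc' (f := fun q => rval q a) hpq.le
    (continuousOn_rval hp ha) ⟨h2.le, h1.le⟩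
  have hqx : rval q a = x := hqx
  have hpq1 : p < q := lt_of_le_of_ne hq.1 (by rintro rfl; linarith)
  have hqq : q < qKL := lt_of_le_of_ne hq.2 (by rintro rfl; linarith)
  exact ⟨q, mem_univoqueBases_iff.mpr
    ⟨hp.trans hpq1, hqq.le.trans qKL_spec.2.1.le, a, ha, hu q hpq1 hqq.le, hqx⟩, hqq⟩

/-- The sequence preceded by `z` zeros. -/
noncomputable def padded (z : ℕ) (a : ℕ → ℝ) : ℕ → ℝ := splice (fun _ => 0) a z

theorem IsDigits.padded {a : ℕ → ℝ} (ha : IsDigits a) (z : ℕ) :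
    IsDigits (ThueMorseBases.padded z a) := IsDigits.splice (fun _ => Or.inl rfl) ha z

theorem padded_lt {a : ℕ → ℝ} {z i : ℕ} (h : i < z) : padded z a i = 0 := splice_lt h

theorem padded_add {a : ℕ → ℝ} {z i : ℕ} : padded z a (z + i) = a i := splice_add

theorem rval_padded {q : ℝ} (hq : 1 < q) {a : ℕ → ℝ} (ha : IsDigits a) (z : ℕ) :
    rval q (padded z a) = rval q a / q ^ z := by
  rw [rval_zeros hq (ha.padded z) fun i hi => padded_lt hi]
  simp only [padded_add]

theorem Univoque.padded {q : ℝ} (hq : 1 < q) {a : ℕ → ℝ} (ha : IsDigits a) (hu : Univoque q a)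
    (h1 : rval q a < 1) (z : ℕ) : Univoque q (ThueMorseBases.padded z a) := by
  intro i
  rcases lt_or_ge i z with hi | hi
  · rw [padded_lt hi]
    refine ⟨fun _ => ?_, fun h => absurd h (by norm_num)⟩
    rw [rval_zeros hq ((ha.padded z).shift (i + 1)) (z := z - (i + 1))
      fun j hj => padded_lt (by omega)]
    have e : ∀ l, ThueMorseBases.padded z a (i + 1 + (z - (i + 1) + l)) = a l := by
      intro l
      rw [← add_assoc, Nat.add_sub_cancel' hi, padded_add]
    simp only [e]
    have h0 := rval_nonneg hq ha
    refine (div_le_self h0 (one_le_pow₀ hq.le)).trans_lt h1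
  · obtain ⟨r, rfl⟩ := Nat.exists_eq_add_of_le hi
    have := hu r
    simp only [add_assoc, padded_add] at this ⊢
    exact this

theorem point_eq (z n : ℕ) : point z n = tmValue n / qKL ^ z := by
  have e : point z n = rval qKL (padded z (fun l => tm (n + l))) := by
    refine tsum_congr fun i => ?_
    congr 1
    simp only [padded, splice, tm, toReal]
    split_ifs <;> simp
  rw [e, rval_padded one_lt_qKL (isDigits_tm.shift n)]
  rfl

theorem exists_univoque_point_lt {p : ℝ} {n : ℕ} (z : ℕ) {d : ℕ → ℝ} (hp : 1 < p) (hpq : p < qKL)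
    (hd : IsDigits d) (hu : ∀ q, p < q → q ≤ qKL → Univoque q d ∧ rval q d < 1)
    (h1 : tmValue n / qKL ^ z < rval p d / p ^ z) (h2 : rval qKL d < tmValue n) :
    ∃ q ∈ univoqueBases (point z n), q < qKL := by
  refine exists_univoque_lt hp hpq (hd.padded z) (fun q h h' => ?_) ?_ ?_
  · exact (hu q h h').1.padded (hp.trans h) hd (hu q h h').2 z
  · rwa [rval_padded hp hd, point_eq]
  · rw [rval_padded one_lt_qKL hd, point_eq]
    have := one_lt_qKL
    gcongr

theorem add_one_lt_sq_of_trunc {q : ℝ} (hq : 1 < q) {k : ℕ} (hk : 1 ≤ k) (h : trunc k q < 1) :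
    q + 1 < q ^ 2 := by
  have := (trunc_mono_index hq hk).trans_lt h
  rw [trunc_one] at this
  have hq0 : 0 < q := by linarith
  have e : 1 / q + 1 / q ^ 2 = (q + 1) / q ^ 2 := by field_simp
  rw [e, div_lt_one (by positivity)] at this
  exact this

theorem univoque_shift_of_reflTail {q : ℝ} (hq : 1 < q) {a : ℕ → ℝ} (ha : IsDigits a) {n : ℕ}
    (h : ∀ i ≥ n, reflTail q a i < 1) : Univoque q (fun l => a (n + l)) := by
  rw [univoque_iff hq (ha.shift n)]
  intro i
  have := h (n + i) (by omega)
  simpa only [reflTail, add_assoc] using this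

theorem periodic_zero (k : ℕ) : periodic k 0 = 0 := by
  rw [periodic_of_lt (by positivity), tm_zero]

theorem univoque_periodic {q : ℝ} (hq : 1 < q) {k : ℕ} (hk : 1 ≤ k) (h : trunc k q < 1) (n : ℕ) :
    Univoque q (fun l => periodic k (n + l)) ∧ rval q (fun l => periodic k (n + l)) < 1 := by
  have hr : ∀ i ≥ 0, reflTail q (periodic k) i < 1 := by
    obtain ⟨k, rfl⟩ := Nat.exists_eq_add_of_le' hk
    exact reflTail_lt_one_of_lt hq (isDigits_periodic _) ((isDigits_periodic _).shift 1)
      (rval_periodic_lt_one hq h) fun i _ => lexLE_periodic k i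
  refine ⟨univoque_shift_of_reflTail hq (isDigits_periodic k) fun i _ => hr i (Nat.zero_le i),
    tail_lt_one hq (add_one_lt_sq_of_trunc hq hk h) (isDigits_periodic k) hr ?_
      (Nat.zero_le n) ?_⟩
  · obtain ⟨k, rfl⟩ := Nat.exists_eq_add_of_le' hk
    intro l
    rw [periodic_even, periodic_odd]
  · rintro rfl
    exact Or.inl (periodic_zero k)

theorem univoque_flipped {q : ℝ} (hq : 1 < q) {k : ℕ} (hk : 1 ≤ k) (h : trunc k q < 1) {n : ℕ}
    (hn : 1 ≤ n) :
    Univoque q (fun l => flipped k (n + l)) ∧ rval q (fun l => flipped k (n + l)) < 1 := by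
  have hr : ∀ i ≥ 1, reflTail q (flipped k) i < 1 := by
    obtain ⟨k, rfl⟩ := Nat.exists_eq_add_of_le' hk
    exact reflTail_lt_one_of_lt hq (isDigits_flipped _) ((isDigits_periodic _).shift 1)
      (rval_periodic_lt_one hq h) (lexLE_flipped k)
  refine ⟨univoque_shift_of_reflTail hq (isDigits_flipped k) fun i hi => hr i (hn.trans hi),
    tail_lt_one hq (add_one_lt_sq_of_trunc hq hk h) (isDigits_flipped k) hr ?_ hn ?_⟩
  · obtain ⟨k, rfl⟩ := Nat.exists_eq_add_of_le' hk
    intro l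
    rw [flipped_even, flipped_odd]
  · rintro rfl
    refine Or.inl ?_
    rw [flipped, if_pos (Nat.one_lt_two_pow (by omega)), tm_one, sub_self]

theorem rval_periodic_cons {q : ℝ} (hq : 1 < q) (k : ℕ) :
    rval q (periodic k) = rval q (fun l => periodic k (1 + l)) / q := by
  rw [rval_cons hq (isDigits_periodic k), periodic_zero, zero_add]

/-- A sequence which starts like `τₙτₙ₊₁…` and continues periodically from a place where a
Thue–Morse block begins has a smaller value in the Komornik–Loreti base. -/
theorem rval_lt_tmValue {k n s m : ℕ} {d : ℕ → ℝ} (hd : IsDigits d)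
    (h1 : ∀ l < s, d l = tm (n + l)) (h2 : ∀ l, d (s + l) = periodic k l)
    (hm : n + s = 2 ^ k * m) : rval qKL d < tmValue n := by
  classical
  -- The two sequences agree up to the first reflected block of length 2^k at or after m. There τ
  -- has 1, while the periodic sequence has 0 followed by a tail less than 1.
  have hex := exists_tm_one m
  set c := Nat.find hex with hc
  have hc1 : tm (m + c) = 1 := Nat.find_spec hex
  have hcmin : ∀ i < c, tm (m + i) = 0 := fun i hi =>
    (isDigits_tm (m + i)).resolve_right (Nat.find_min hex hi)
  set L := s + 2 ^ k * c with hL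
  have agree : ∀ i < L, d i = tm (n + i) := by
    intro i hi
    rcases lt_or_ge i s with h | h
    · exact h1 i h
    · obtain ⟨r, rfl⟩ := Nat.exists_eq_add_of_le h
      have hr : r / 2 ^ k < c := Nat.div_lt_of_lt_mul (by omega)
      rw [h2, ← add_assoc, hm, periodic]
      conv_rhs => rw [← Nat.div_add_mod r (2 ^ k), ← add_assoc, ← mul_add]
      rw [tm_block_zero (Nat.mod_lt _ (by positivity)) (hcmin _ hr)]
  have hq := one_lt_qKL
  have hsp : tmValue n = ∑ i ∈ Finset.range L, tm (n + i) / qKL ^ (i + 1) +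
      tmValue (n + L) / qKL ^ L := by
    unfold tmValue
    rw [rval_split hq (isDigits_tm.shift n) L]
    simp only [add_assoc]
  rw [rval_split hq hd L, hsp,
    Finset.sum_congr rfl fun i hi => by rw [agree i (Finset.mem_range.mp hi)]]
  have e1 : rval qKL (fun l => d (L + l)) = rval qKL (periodic k) := by
    refine rval_congr fun l => ?_
    rw [hL, add_assoc, h2, periodic, periodic, Nat.mul_add_mod]
  have e2 : tm (n + L) = 1 := by
    rw [hL, ← add_assoc, hm, ← mul_add, tm_pow_mul, hc1]
  rw [e1, rval_periodic_cons hq, tmValue_eq, e2]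
  have h3 := rval_periodic_lt_one hq (trunc_qKL_lt k)
  have h4 := tmValue_pos (n + L + 1)
  gcongr
  linarith

/-- From the place where `d` becomes periodic it has value exactly 1/p in base p, whereas τ, having
the digit 0 there, has value below 1/`qKL`; the common initial digits also weigh at least as much in
the smaller base. -/
theorem tmValue_lt_rval {p : ℝ} (hp : 1 < p) (hpq : p < qKL) {k n s : ℕ}
    (hkp : trunc k p = 1) {d : ℕ → ℝ} (hd : IsDigits d)
    (h1 : ∀ l < s, d l = tm (n + l)) (h2 : ∀ l, d (s + l) = periodic k l)
    (hn : 1 ≤ n + s) (hm0 : tm (n + s) = 0) : tmValue n < rval p d := by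
  have hq := one_lt_qKL
  have hsp : tmValue n = ∑ i ∈ Finset.range s, tm (n + i) / qKL ^ (i + 1) +
      tmValue (n + s) / qKL ^ s := by
    unfold tmValue
    rw [rval_split hq (isDigits_tm.shift n) s]
    simp only [add_assoc]
  rw [rval_split hp hd s, hsp,
    Finset.sum_congr rfl fun i hi => by rw [← h1 i (Finset.mem_range.mp hi)]]
  simp only [h2]
  rw [show rval p (fun l => periodic k l) = rval p (periodic k) from rfl, rval_periodic_cons hp,
    rval_periodic_eq_one hp hkp, tmValue_eq, hm0, zero_add]
  refine add_lt_add_of_le_of_lt (sum_anti hp hpq.le hd s) ?_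
  have := tmValue_succ_lt hn hm0
  have h3 : tmValue (n + s + 1) / qKL < 1 / p := by gcongr
  have h0 : 0 < 1 / p := by positivity
  calc tmValue (n + s + 1) / qKL / qKL ^ s < 1 / p / qKL ^ s := by gcongr
    _ ≤ 1 / p / p ^ s := by gcongr

theorem div_pow_lt_div_pow {p x y : ℝ} (hp : 1 < p) (hpq : p < qKL) (hx : 0 ≤ x) (h : x < y)
    (z : ℕ) : x / qKL ^ z < y / p ^ z := by
  have := one_lt_qKL
  calc x / qKL ^ z < y / qKL ^ z := by gcongr
    _ ≤ y / p ^ z := by gcongr; linarith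

/-- The digits from n to the offending unreflected block are kept and the sequence is continued
periodically from there. According to the digit `tm b` of the block before, this is a tail of
`periodic` or of `flipped`. -/
theorem exists_of_not_blocksReflected {n : ℕ} (z : ℕ) (h : ¬ BlocksReflected n) :
    ∃ q ∈ univoqueBases (point z n), q < qKL := by
  unfold BlocksReflected at h
  push Not at h
  obtain ⟨k, hk, b, j, hn, hj1, hj2, hb⟩ := h
  have hb0 : tm (b + 1) = 0 := (isDigits_tm (b + 1)).resolve_right hb
  obtain ⟨p, hp, hpq, hkp⟩ := exists_base hk
  have hp1 : 1 < p := by linarith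
  have hs : n + (2 ^ k - j) = 2 ^ k * (b + 1) := by
    rw [mul_add]
    omega
  have main : ∀ d : ℕ → ℝ, IsDigits d →
      (∀ q, p < q → q ≤ qKL → Univoque q d ∧ rval q d < 1) →
      (∀ l < 2 ^ k - j, d l = tm (n + l)) → (∀ l, d (2 ^ k - j + l) = periodic k l) →
      ∃ q ∈ univoqueBases (point z n), q < qKL := by
    intro d hd hu h1 h2
    refine exists_univoque_point_lt z hp1 hpq hd hu ?_ (rval_lt_tmValue hd h1 h2 hs)
    refine div_pow_lt_div_pow hp1 hpq (tmValue_pos n).le ?_ z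
    exact tmValue_lt_rval hp1 hpq hkp hd h1 h2 (by omega) (by rw [hs, tm_pow_mul, hb0])
  have ej : ∀ l, j + (2 ^ k - j + l) = 2 ^ k + l := by
    intro l
    omega
  rcases isDigits_tm b with h0 | h1
  · refine main (fun l => periodic k (j + l)) ((isDigits_periodic k).shift j)
      (fun q hq _ => univoque_periodic (hp1.trans hq) hk (trunc_lt_of_lt hp1 hkp hq) j)
      (fun l hl => ?_) (fun l => ?_)
    · rw [periodic_of_lt (by omega), hn, add_assoc, tm_block_zero (by omega) h0]
    · rw [ej, periodic_add]
  · refine main (fun l => flipped k (j + l)) ((isDigits_flipped k).shift j)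
      (fun q hq _ => univoque_flipped (hp1.trans hq) hk (trunc_lt_of_lt hp1 hkp hq) hj1)
      (fun l hl => ?_) (fun l => ?_)
    · rw [flipped, if_pos (by omega), hn, add_assoc, tm_block_one (by omega) h1]
    · rw [ej, flipped_add]

/-- Now τₙτₙ₊₁… starts like τ₁τ₂…, and the periodic sequence read from index 1 has value 1 in base
p, more than `tmValue n` for n ≥ 2. -/
theorem exists_of_not_startsReflected {n : ℕ} (hn : 2 ≤ n) (z : ℕ) (h : ¬ StartsReflected n) :
    ∃ q ∈ univoqueBases (point z n), q < qKL := by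
  unfold StartsReflected at h
  push Not at h
  obtain ⟨k, hk, a, hna, ha⟩ := h
  have ha0 : tm a = 0 := (isDigits_tm a).resolve_right ha
  obtain ⟨p, hp, hpq, hkp⟩ := exists_base hk
  have hp1 : 1 < p := by linarith
  refine exists_univoque_point_lt z hp1 hpq ((isDigits_periodic k).shift 1)
    (fun q hq _ => univoque_periodic (hp1.trans hq) hk (trunc_lt_of_lt hp1 hkp hq) 1) ?_ ?_
  · refine div_pow_lt_div_pow hp1 hpq (tmValue_pos n).le ?_ z
    rw [rval_periodic_eq_one hp1 hkp]
    exact tmValue_lt_one hn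
  · have := rval_lt_tmValue (k := k) (n := 2 ^ k * a) (s := 0) (m := a) (isDigits_periodic k)
      (fun l hl => absurd hl (Nat.not_lt_zero l)) (fun l => by rw [zero_add]) rfl
    rw [rval_periodic_cons one_lt_qKL, tmValue_eq, tm_pow_mul, ha0, zero_add, ← hna] at this
    exact (div_lt_div_iff_of_pos_right (by linarith [one_lt_qKL])).mp this

theorem exists_of_one {z : ℕ} (hz : 1 ≤ z) : ∃ q ∈ univoqueBases (point z 1), q < qKL := by
  obtain ⟨p, hp, hpq, hkp⟩ := exists_base le_rfl
  have hp1 : 1 < p := by linarith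
  refine exists_univoque_point_lt z hp1 hpq ((isDigits_periodic 1).shift 1)
    (fun q hq _ => univoque_periodic (hp1.trans hq) le_rfl (trunc_lt_of_lt hp1 hkp hq) 1) ?_ ?_
  · rw [rval_periodic_eq_one hp1 hkp, tmValue_one]
    gcongr
  · rw [tmValue_one]
    exact rval_periodic_lt_one one_lt_qKL (trunc_qKL_lt 1)

theorem exists_of_not_mem_S {n z : ℕ} (hn : 1 ≤ n) (h : n ∉ S) (h1 : n = 1 → 1 ≤ z) :
    ∃ q ∈ univoqueBases (point z n), q < qKL := by
  rcases hn.lt_or_eq with h2 | rfl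
  · rw [mem_S_iff_conditions h2, not_and_or] at h
    rcases h with h | h
    · exact exists_of_not_blocksReflected z h
    · exact exists_of_not_startsReflected h2 z h
  · exact exists_of_one (h1 rfl)

theorem bddBelow_univoqueBases (x : ℝ) : BddBelow (univoqueBases x) :=
  ⟨1, fun _ hq => (hq : _ ∧ _).1.le⟩

theorem qs_ne_of_exists {x : ℝ} (h : ∃ q ∈ univoqueBases x, q < qKL) : qs x ≠ qKL := by
  obtain ⟨q, hq, hlt⟩ := h
  exact ((csInf_le (bddBelow_univoqueBases x) hq).trans_lt hlt).ne

theorem univoque_tm {n : ℕ} (hn : 1 ≤ n) : Univoque qKL (fun l => tm (n + l)) :=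
  univoque_shift_of_reflTail one_lt_qKL isDigits_tm fun _ hi => reflTail_tm_lt (hn.trans hi)

theorem qKL_mem {n z : ℕ} (hn : 1 ≤ n) (h1 : n = 1 → z = 0) :
    qKL ∈ univoqueBases (point z n) := by
  refine mem_univoqueBases_iff.mpr ⟨one_lt_qKL, qKL_spec.2.1.le, padded z (fun l => tm (n + l)),
    (isDigits_tm.shift n).padded z, ?_, ?_⟩
  · rcases hn.lt_or_eq with h2 | rfl
    · exact (univoque_tm hn).padded one_lt_qKL (isDigits_tm.shift n) (tmValue_lt_one h2) z
    · obtain rfl := h1 rfl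
      have e : padded 0 (fun l => tm (1 + l)) = fun l => tm (1 + l) := by
        funext l
        simp [padded, splice]
      rw [e]
      exact univoque_tm le_rfl
  · rw [rval_padded one_lt_qKL (isDigits_tm.shift n), point_eq]
    rfl

theorem qs_point_eq {n z : ℕ} (hn : 1 ≤ n) (h1 : n = 1 → z = 0)
    (h : ∀ q ∈ univoqueBases (point z n), qKL ≤ q) : qs (point z n) = qKL :=
  IsLeast.csInf_eq ⟨qKL_mem hn h1, h⟩

/-! ### Univoque expansions in bases below the Komornik–Loreti constant -/

/-- The value of `τₙ…τₙ₊ₛ₋₁1` in base `q`. -/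
noncomputable def roundUp (q : ℝ) (n s : ℕ) : ℝ :=
  ∑ i ∈ Finset.range s, tm (n + i) / q ^ (i + 1) + 1 / q ^ (s + 1)

theorem roundUp_anti {p q : ℝ} (hp : 1 < p) (hpq : p ≤ q) (n s : ℕ) :
    roundUp q n s ≤ roundUp p n s := by
  refine add_le_add (sum_anti hp hpq (isDigits_tm.shift n) s) ?_
  gcongr

theorem tmValue_split (n s : ℕ) : tmValue n =
    ∑ i ∈ Finset.range s, tm (n + i) / qKL ^ (i + 1) +
      (tm (n + s) + tmValue (n + s + 1)) / qKL ^ (s + 1) := by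
  have := rval_split one_lt_qKL (isDigits_tm.shift n) s
  have e : rval qKL (fun l => tm (n + (s + l))) = tmValue (n + s) := by
    simp only [← add_assoc]
    rfl
  rw [e, tmValue_eq] at this
  rw [show tmValue n = rval qKL (fun l => tm (n + l)) from rfl, this, pow_succ, div_div,
    mul_comm qKL]

theorem tail_padded_le_one {n : ℕ} (hn : 1 ≤ n) (z j : ℕ) :
    rval qKL (fun l => padded z (fun l => tm (n + l)) (j + l)) ≤ 1 := by
  have hd := (isDigits_tm.shift n).padded z
  rcases le_or_gt z j with h | h
  · obtain ⟨r, rfl⟩ := Nat.exists_eq_add_of_le h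
    simp only [add_assoc, padded_add]
    simp only [← add_assoc]
    exact tmValue_le_one (by omega : 1 ≤ n + r)
  · rw [rval_zeros one_lt_qKL (hd.shift j) (z := z - j) fun i hi => padded_lt (by omega)]
    have e : ∀ l, padded z (fun l => tm (n + l)) (j + (z - j + l)) = tm (n + l) := by
      intro l
      rw [← add_assoc, Nat.add_sub_cancel' h.le, padded_add]
    simp only [e]
    exact (div_le_self (tmValue_pos n).le (one_le_pow₀ one_lt_qKL.le)).trans (tmValue_le_one hn)

/-- An expansion of `0…0τₙτₙ₊₁…` in a smaller base is lexicographically smaller. -/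
theorem exists_first_difference {q : ℝ} (hq : 1 < q) (hqK : q < qKL) {a : ℕ → ℝ}
    (ha : IsDigits a) {n z : ℕ} (hn : 1 ≤ n) (hv : rval q a = tmValue n / qKL ^ z) :
    ∃ s, (∀ i < z, a i = 0) ∧ (∀ l < s, a (z + l) = tm (n + l)) ∧ a (z + s) = 0 ∧
      tm (n + s) = 1 := by
  set θ := padded z (fun l => tm (n + l)) with hθ
  have hθd : IsDigits θ := (isDigits_tm.shift n).padded z
  have hv : rval q a = rval qKL θ := by
    rw [hv, hθ, rval_padded one_lt_qKL (isDigits_tm.shift n)]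
    rfl
  have hne : a ≠ θ := by
    intro e
    rw [e] at hv
    obtain ⟨i, hi⟩ := exists_tm_one n
    have := rval_strictAnti hq hqK hθd (i := z + i) (by rw [hθ, padded_add, hi])
    exact this.ne' hv
  obtain ⟨L, hlt, hL⟩ := exists_first_ne hne
  rcases hθd L with h0 | h1
  · exfalso
    -- If a were larger at L, its digit 1, weighted in the smaller base, would already outweigh
    -- everything in θ from L on, whose tail behind L is at most 1.
    have h1 : a L = 1 := (ha L).resolve_left fun h => hL (h.trans h0.symm)
    rw [rval_split hq ha L, rval_split one_lt_qKL hθd L, rval_shift_cons hq ha,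
      rval_shift_cons one_lt_qKL hθd, h0, h1,
      Finset.sum_congr rfl fun i hi => by rw [hlt i (Finset.mem_range.mp hi)]] at hv
    have hs := sum_anti hq hqK.le hθd L
    have ht := tail_padded_le_one hn z (L + 1)
    rw [← hθ] at ht
    have hr := rval_nonneg hq (ha.shift (L + 1))
    have hK := one_lt_qKL
    have e1 : (0 + rval qKL (fun l => θ (L + 1 + l))) / qKL / qKL ^ L ≤ 1 / qKL / qKL ^ L := by
      gcongr
      linarith
    have e2 : 1 / qKL / qKL ^ L < 1 / q / qKL ^ L := by gcongr
    have e3 : 1 / q / qKL ^ L ≤ (1 + rval q (fun l => a (L + 1 + l))) / q / q ^ L := by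
      gcongr
      linarith
    linarith
  · have h0 : a L = 0 := (ha L).resolve_right fun h => hL (h.trans h1.symm)
    have hz : z ≤ L := by
      by_contra hz
      rw [hθ, padded_lt (by omega)] at h1
      norm_num at h1
    obtain ⟨s, rfl⟩ := Nat.exists_eq_add_of_le hz
    refine ⟨s, fun i hi => ?_, fun l hl => ?_, h0, ?_⟩
    · rw [hlt i (by omega), hθ, padded_lt hi]
    · rw [hlt _ (by omega), hθ, padded_add]
    · rw [hθ, padded_add] at h1
      exact h1

theorem rval_lt_roundUp {q : ℝ} (hq : 1 < q) {e : ℕ → ℝ} (he : IsDigits e) (hu : Univoque q e)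
    {n s : ℕ} (h : ∀ l < s, e l = tm (n + l)) (h0 : e s = 0) : rval q e < roundUp q n s := by
  rw [rval_split hq he s, rval_shift_cons hq he, h0, zero_add, roundUp,
    Finset.sum_congr rfl fun i hi => by rw [h i (Finset.mem_range.mp hi)], div_div, ← pow_succ']
  have := (hu s).1 h0
  gcongr

/-- A tail above τ₁τ₂… has value at least 1 in any base below `qKL`, because τ₁τ₂… has value 1 in
base `qKL` and all its tails are at most 1. So it cannot follow a 0. -/
theorem Univoque.not_exceed {q : ℝ} (hq : 1 < q) (hqK : q < qKL) {e : ℕ → ℝ} (he : IsDigits e)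
    (hu : Univoque q e) {P i : ℕ} (h0 : e P = 0) (h : ∀ l < i, e (P + 1 + l) = tm (1 + l))
    (h1 : e (P + 1 + i) = 1) (hi : tm (1 + i) = 0) : False := by
  have h2 := (hu P).1 h0
  have h3 := tmValue_split 1 i
  rw [tmValue_one, hi, zero_add] at h3
  rw [rval_split hq (he.shift (P + 1)) i,
    Finset.sum_congr rfl fun l hl => by rw [h l (Finset.mem_range.mp hl)]] at h2
  simp only [← add_assoc] at h2
  rw [rval_shift_cons hq he, h1, div_div, ← pow_succ'] at h2
  have h4 := sum_anti hq hqK.le (isDigits_tm.shift 1) i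
  have h5 := rval_nonneg hq (he.shift (P + 1 + i + 1))
  have h6 := tmValue_le_one (n := 1 + i + 1) (by omega)
  have hK := one_lt_qKL
  have h7 : tmValue (1 + i + 1) / qKL ^ (i + 1) ≤ 1 / q ^ (i + 1) := by gcongr
  have h8 : 1 / q ^ (i + 1) ≤ (1 + rval q fun l => e (P + 1 + i + 1 + l)) / q ^ (i + 1) := by
    gcongr
    linarith
  linarith

theorem geom_sum_inv {q : ℝ} (hq : 1 < q) (N : ℕ) :
    ∑ i ∈ Finset.range N, 1 / q ^ (i + 1) = (1 - 1 / q ^ N) / (q - 1) := by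
  have h1 : q - 1 ≠ 0 := by linarith
  have h2 : q ≠ 0 := by linarith
  induction N with
  | zero => simp
  | succ N ih =>
    rw [Finset.sum_range_succ, ih]
    field_simp
    ring

/-- The second half of τ₁…τ_{2^(k+1)} is the reflection of the first half, except that its last
digit is 1. The first factor has the sign of a univoqueness condition; see `Univoque.trunc_lt`. -/
theorem trunc_succ {q : ℝ} (hq : 1 < q) (k : ℕ) : trunc (k + 1) q - 1 =
    (trunc k q - 1 + (1 / (q - 1) - 1) / q ^ 2 ^ k) * (1 - 1 / q ^ 2 ^ k) := by
  obtain ⟨B, hB⟩ : ∃ B, 2 ^ k = B + 1 := ⟨2 ^ k - 1, by have := Nat.two_pow_pos k; omega⟩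
  have e1 : trunc (k + 1) q = trunc k q +
      ∑ i ∈ Finset.range (2 ^ k), tm (1 + (2 ^ k + i)) / q ^ (2 ^ k + i + 1) := by
    rw [trunc, pow_succ, mul_two, Finset.sum_range_add]
    rfl
  have e2 : ∑ i ∈ Finset.range (2 ^ k), tm (1 + (2 ^ k + i)) / q ^ (2 ^ k + i + 1) =
      (∑ i ∈ Finset.range (2 ^ k), (1 - tm (1 + i)) / q ^ (i + 1) + 1 / q ^ 2 ^ k) /
        q ^ 2 ^ k := by
    have hl1 : tm (1 + (B + 1 + B)) = 1 := by
      rw [show 1 + (B + 1 + B) = 2 ^ (k + 1) by rw [pow_succ]; omega, tm_pow]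
    have hl2 : tm (1 + B) = 1 := by rw [show 1 + B = 2 ^ k by omega, tm_pow]
    rw [hB, Finset.sum_range_succ, Finset.sum_range_succ, hl1, hl2, sub_self, zero_div, add_zero,
      add_div, Finset.sum_div]
    congr 1
    · refine Finset.sum_congr rfl fun i hi => ?_
      have hi := Finset.mem_range.mp hi
      have := tm_block_one (k := k) (a := 1) (i := 1 + i) (by omega) tm_one
      rw [hB, mul_one] at this
      rw [show 1 + (B + 1 + i) = B + 1 + (1 + i) by ring, this, div_div, ← pow_add]
      congr 2
      ring
    · rw [div_div, ← pow_add]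
      congr 2
  have e3 : ∑ i ∈ Finset.range (2 ^ k), (1 - tm (1 + i)) / q ^ (i + 1) =
      (1 - 1 / q ^ 2 ^ k) / (q - 1) - trunc k q := by
    rw [← geom_sum_inv hq, trunc, ← Finset.sum_sub_distrib]
    exact Finset.sum_congr rfl fun i _ => by ring
  rw [e1, e2, e3]
  have h1 : q - 1 ≠ 0 := by linarith
  have h2 : q ≠ 0 := by linarith
  field_simp
  ring

/-- The block ends in τ_{2^k} = 1, so what follows exceeds 1/(q-1) - 1, while the whole tail after
the 0 is below 1. Together this makes the first factor in `trunc_succ` negative. -/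
theorem Univoque.trunc_lt {q : ℝ} (hq : 1 < q) {f : ℕ → ℝ} (hf : IsDigits f) (hu : Univoque q f)
    {P k : ℕ} (h0 : f P = 0) (h : ∀ l < 2 ^ k, f (P + 1 + l) = tm (1 + l)) :
    trunc (k + 1) q < 1 := by
  have h2 := (hu P).1 h0
  rw [rval_split hq (hf.shift (P + 1)) (2 ^ k),
    Finset.sum_congr rfl fun l hl => by rw [h l (Finset.mem_range.mp hl)]] at h2
  obtain ⟨B, hB⟩ : ∃ B, 2 ^ k = B + 1 := ⟨2 ^ k - 1, by have := Nat.two_pow_pos k; omega⟩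
  have h3 : f (P + 2 ^ k) = 1 := by
    have := h B (by omega)
    rwa [show P + 1 + B = P + 2 ^ k by omega, show 1 + B = 2 ^ k by omega, tm_pow] at this
  have h4 := (hu _).2 h3
  have e : ∀ l, P + 2 ^ k + 1 + l = P + 1 + (2 ^ k + l) := fun l => by ring
  simp only [e] at h4
  have h5 : (1 / (q - 1) - 1) / q ^ 2 ^ k < rval q (fun l => f (P + 1 + (2 ^ k + l))) / q ^ 2 ^ k := by
    gcongr
    linarith
  have h6 : trunc k q - 1 + (1 / (q - 1) - 1) / q ^ 2 ^ k < 0 := by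
    unfold trunc
    linarith
  have := mul_neg_of_neg_of_pos h6 (inv_pow_two_pow_lt_one hq k)
  rw [← trunc_succ hq] at this
  linarith

theorem exists_change {e : ℕ → ℝ} {i j : ℕ} (h : e i ≠ e j) : ∃ P, e P ≠ e (P + 1) := by
  by_contra hc
  push Not at hc
  have : ∀ i, e i = e 0 := by
    intro i
    induction i with
    | zero => rfl
    | succ i ih => rw [← hc i, ih]
  exact h ((this i).trans (this j).symm)

/-- A nonconstant sequence contains 01 or 10; the previous lemma at level 0, applied to it or to its
reflection, puts q above the golden ratio. -/
theorem Univoque.trunc_one_lt {q : ℝ} (hq : 1 < q) {e : ℕ → ℝ} (he : IsDigits e)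
    (hu : Univoque q e) {s : ℕ} (h0 : e s = 0) (hpos : 0 < rval q e) : trunc 1 q < 1 := by
  have hex : ∃ i, e i ≠ e s := by
    by_contra hc
    push Not at hc
    have : rval q e = 0 := by
      unfold rval
      simp [hc, h0]
    linarith
  obtain ⟨i, hi⟩ := hex
  obtain ⟨P, hP⟩ := exists_change hi
  rcases he P with hp | hp
  · have h1 : e (P + 1) = 1 := (he _).resolve_left fun h => hP (hp.trans h.symm)
    refine hu.trunc_lt hq he (P := P) (k := 0) hp fun l hl => ?_
    obtain rfl : l = 0 := by simpa using hl
    rw [add_zero, h1, add_zero, tm_one]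
  · have h1 : e (P + 1) = 0 := (he _).resolve_right fun h => hP (hp.trans h.symm)
    refine (hu.compl hq he).trunc_lt hq he.compl (P := P) (k := 0) (by rw [hp, sub_self])
      fun l hl => ?_
    obtain rfl : l = 0 := by simpa using hl
    rw [add_zero, h1, add_zero, tm_one, sub_zero]

/-- A univoque sequence which first falls below `τₙτₙ₊₁…` does so at the beginning of a block. -/
theorem exists_block_of_first_difference {q : ℝ} (hq : 1 < q) (hqK : q < qKL) {e : ℕ → ℝ}
    (he : IsDigits e) (hu : Univoque q e) {n s : ℕ} (hn : 1 ≤ n) (hB : BlocksReflected n)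
    (h : ∀ l < s, e l = tm (n + l)) (h0 : e s = 0) (h1 : tm (n + s) = 1) :
    ∃ k b j, n = 2 ^ k * b + j ∧ 1 ≤ j ∧ j ≤ 2 ^ k ∧ n + s = 2 ^ k * (b + 1) ∧
      (1 ≤ k → j ≤ 2 ^ (k - 1)) := by
  classical
  -- The least k such that n and n + s lie in a common interval (2^k b, 2^k (b + 1)]. The quotient
  -- of n - 1 makes the right end belong to the interval.
  have hex : ∃ k, n + s ≤ 2 ^ k * ((n - 1) / 2 ^ k + 1) :=
    ⟨n + s, (Nat.lt_two_pow_self).le.trans (Nat.le_mul_of_pos_right _ (Nat.succ_pos _))⟩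
  have hk := Nat.find_spec hex
  have hmin := fun i => Nat.find_min (H := hex) (m := i)
  generalize Nat.find hex = k at hk hmin
  have hdm := Nat.div_add_mod (n - 1) (2 ^ k)
  have hlt := Nat.mod_lt (n - 1) (Nat.two_pow_pos k)
  rcases Nat.eq_zero_or_pos k with rfl | hk1
  · refine ⟨0, n - 1, 1, ?_, le_rfl, le_rfl, ?_, fun h => absurd h (by norm_num)⟩ <;>
      simp at hk ⊢ <;> omega
  · obtain ⟨k, rfl⟩ : ∃ k', k = k' + 1 := ⟨k - 1, by omega⟩
    have hlow := hmin k (by omega)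
    have hdm2 := Nat.div_add_mod (n - 1) (2 ^ k)
    have hlt2 := Nat.mod_lt (n - 1) (Nat.two_pow_pos k)
    -- By minimality n + s lies beyond the end of the shorter interval, where a reflected block
    -- begins. A first difference inside that block would make the reflection of e exceed τ₁τ₂…
    -- after a 0, so n + s is at or past its end.
    have hstep : 2 ^ k * ((n - 1) / 2 ^ k + 1) + 2 ^ k ≤ n + s := by
      by_contra hc
      set b := (n - 1) / 2 ^ k with hb
      have eM : 2 ^ k * (b + 1) = 2 ^ k * b + 2 ^ k := by ring
      rcases Nat.eq_zero_or_pos k with rfl | hk0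
      · simp at hlow hc
        omega
      · have hb1 : tm (b + 1) = 1 := hB k hk0 b ((n - 1) % 2 ^ k + 1) (by omega) (by omega)
          (by omega)
        obtain ⟨P, hP⟩ : ∃ P, 2 ^ k * (b + 1) = n + P :=
          ⟨2 ^ k * (b + 1) - n, by omega⟩
        obtain ⟨i, hi⟩ : ∃ i, s = P + 1 + i := ⟨s - P - 1, by omega⟩
        have hbl : ∀ l < 2 ^ k, tm (n + (P + l)) = 1 - tm l := by
          intro l hl
          rw [← add_assoc, ← hP, tm_block_one hl hb1]
        refine (hu.compl hq he).not_exceed hq hqK he.compl (P := P) (i := i) ?_ (fun l hl => ?_) ?_ ?_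
        · have := hbl 0 (by positivity)
          rw [add_zero, tm_zero] at this
          rw [h P (by omega), this]
          ring
        · rw [h _ (by omega), add_assoc P, hbl (1 + l) (by omega)]
          ring
        · rw [← hi, h0, sub_zero]
        · have := hbl (1 + i) (by omega)
          rw [← add_assoc P, ← hi, h1] at this
          linarith
    set b := (n - 1) / 2 ^ (k + 1) with hb
    have hbb : (n - 1) / 2 ^ k = 2 * b ∨ (n - 1) / 2 ^ k = 2 * b + 1 := by
      have : (n - 1) / 2 ^ (k + 1) = (n - 1) / 2 ^ k / 2 := by
        rw [pow_succ, Nat.div_div_eq_div_mul]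
      omega
    have ep : 2 ^ (k + 1) = 2 * 2 ^ k := pow_succ' 2 k
    have eb : 2 ^ (k + 1) * (b + 1) = 2 ^ k * (2 * b) + 2 * 2 ^ k := by rw [ep]; ring
    have eb2 : 2 ^ (k + 1) * b = 2 ^ k * (2 * b) := by rw [ep]; ring
    rcases hbb with h2 | h2
    · rw [h2] at hdm2 hstep
      rw [mul_add] at hstep
      refine ⟨k + 1, b, (n - 1) % 2 ^ k + 1, ?_, ?_, ?_, ?_, fun _ => ?_⟩
      · omega
      · omega
      · omega
      · omega
      · rw [Nat.add_sub_cancel]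
        omega
    · exfalso
      rw [h2] at hdm2 hstep
      have : 2 ^ k * (2 * b + 1 + 1) = 2 ^ k * (2 * b) + 2 * 2 ^ k := by ring
      have := Nat.two_pow_pos k
      omega

/-! ### Estimates -/

theorem inv_qKL_bounds : 0.5595 < 1 / qKL ∧ 1 / qKL < 0.5596 := by
  have h1 := qKL_gt
  have h2 := qKL_lt
  constructor
  · rw [lt_div_iff₀ (by linarith)]
    linarith
  · rw [div_lt_iff₀ (by linarith)]
    linarith

theorem gap_gt : 0.2701 < 1 / (qKL - 1) - 1 := by
  have h1 := qKL_gt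
  have h2 := qKL_lt
  rw [lt_sub_iff_add_lt, lt_div_iff₀ (by linarith)]
  linarith

theorem tmValue_succ (j : ℕ) : tmValue (j + 1) = qKL * tmValue j - tm j := by
  have := tmValue_eq j
  have h := one_lt_qKL
  field_simp at this
  linarith

theorem rval_periodic_succ {p : ℝ} (hp : 1 < p) (k j : ℕ) :
    rval p (fun l => periodic k (j + 1 + l)) =
      p * rval p (fun l => periodic k (j + l)) - periodic k j := by
  have := rval_shift_cons hp (isDigits_periodic k) j
  field_simp at this
  linarith

theorem tmValue_two : tmValue 2 = qKL - 1 := by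
  rw [tmValue_succ 1, tmValue_one, tm_one, mul_one]

theorem rval_periodic_two {p : ℝ} (hp : 1 < p) {k : ℕ} (hk : 1 ≤ k) (hkp : trunc k p = 1) :
    rval p (fun l => periodic k (2 + l)) = p - 1 := by
  rw [rval_periodic_succ hp k 1, rval_periodic_eq_one hp hkp,
    periodic_of_lt (Nat.one_lt_two_pow (by omega)), tm_one, mul_one]

/-- Both tails obey v ↦ base · v - digit with the same digits, starting at index 2 from `qKL` - 1
and p - 1; each step multiplies their difference by at least `qKL`. -/
theorem le_tmValue_sub {p : ℝ} (hp : 1 < p) (hpq : p < qKL) {k : ℕ} (hk : 1 ≤ k)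
    (hkp : trunc k p = 1) (i : ℕ) (hi : i + 2 ≤ 2 ^ k) :
    qKL ^ i * (qKL - p) ≤ tmValue (i + 2) - rval p (fun l => periodic k (i + 2 + l)) := by
  induction i with
  | zero => simp [tmValue_two, rval_periodic_two hp hk hkp]
  | succ i ih =>
    have h := ih (by omega)
    rw [show i + 1 + 2 = i + 2 + 1 by ring, tmValue_succ, rval_periodic_succ hp,
      periodic_of_lt (by omega)]
    have h1 := mul_le_mul_of_nonneg_left h (by linarith [one_lt_qKL] : 0 ≤ qKL)
    have h2 : 0 ≤ (qKL - p) * rval p (fun l => periodic k (i + 2 + l)) :=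
      mul_nonneg (by linarith) (rval_nonneg hp ((isDigits_periodic k).shift _))
    rw [pow_succ]
    nlinarith

theorem inv_sub_inv_ge {p : ℝ} (hp : 1 < p) (hpq : p < qKL) :
    (qKL - p) / qKL ^ 2 ≤ 1 / p - 1 / qKL := by
  have h := one_lt_qKL
  have e : 1 / p - 1 / qKL = (qKL - p) / (p * qKL) := by field_simp
  rw [e]
  have : p * qKL ≤ qKL ^ 2 := by nlinarith
  have : 0 ≤ qKL - p := by linarith
  gcongr

/-- Dividing by the z-th power of the base moves the index back from i + z to i, up to the digits
passed over, whose contribution favours the smaller base p. At i = 1 both tails equal 1, so the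
whole gain comes from the digit τ₁; hence z ≥ 1 is required there. -/
theorem gain {p : ℝ} (hp : 1 < p) (hpq : p < qKL) {k : ℕ} (hk : 1 ≤ k)
    (hkp : trunc k p = 1) {i z : ℕ} (hi : 1 ≤ i) (hz : z ≤ 2) (hiz : 2 ≤ i ∨ 1 ≤ z)
    (hB : i + z ≤ 2 ^ k) : (qKL - p) * qKL ^ i / qKL ^ 3 ≤
      tmValue (i + z) / qKL ^ z - rval p (fun l => periodic k (i + z + l)) / p ^ z := by
  have hK := one_lt_qKL
  have hinv := inv_sub_inv_ge hp hpq
  have h0 : 0 ≤ qKL - p := by linarith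
  have hpos : 0 ≤ 1 / p - 1 / qKL := le_trans (by positivity) hinv
  have hpos2 : 0 ≤ 1 / p ^ 2 - 1 / qKL ^ 2 := by
    rw [sub_nonneg]
    gcongr
  have key : (qKL - p) * qKL ^ i / qKL ^ 3 ≤ tmValue i - rval p (fun l => periodic k (i + l)) +
      (if z = 0 then 0 else tm i * (1 / p - 1 / qKL)) := by
    rcases hi.lt_or_eq with h2 | rfl
    · obtain ⟨i, rfl⟩ : ∃ r, i = r + 2 := ⟨i - 2, by omega⟩
      have h3 := le_tmValue_sub hp hpq hk hkp i (by omega)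
      have h4 : (qKL - p) * qKL ^ (i + 2) / qKL ^ 3 ≤ qKL ^ i * (qKL - p) := by
        rw [div_le_iff₀ (by positivity)]
        have e : qKL ^ i * (qKL - p) * qKL ^ 3 = (qKL - p) * qKL ^ (i + 2) * qKL := by ring
        rw [e]
        exact le_mul_of_one_le_right (by positivity) hK.le
      have h5 : 0 ≤ if z = 0 then 0 else tm (i + 2) * (1 / p - 1 / qKL) := by
        split_ifs
        · exact le_rfl
        · exact mul_nonneg (isDigits_tm.nonneg _) hpos
      linarith
    · rw [if_neg (by omega), tmValue_one, rval_periodic_eq_one hp hkp, tm_one]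
      have e : (qKL - p) * qKL ^ 1 / qKL ^ 3 = (qKL - p) / qKL ^ 2 := by
        field_simp
      rw [e]
      linarith
  have e1 : ∀ j, tmValue (j + 1) / qKL = tmValue j - tm j * (1 / qKL) := by
    intro j
    rw [tmValue_succ]
    field_simp
  have e2 : ∀ j < 2 ^ k, rval p (fun l => periodic k (j + 1 + l)) / p =
      rval p (fun l => periodic k (j + l)) - tm j * (1 / p) := by
    intro j hj
    rw [rval_periodic_succ hp, periodic_of_lt hj]
    field_simp
  obtain rfl | rfl | rfl : z = 0 ∨ z = 1 ∨ z = 2 := by omega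
  · simpa using key
  · rw [if_neg one_ne_zero] at key
    rw [pow_one, pow_one, e1, e2 i (by omega)]
    linarith
  · rw [if_neg two_ne_zero] at key
    have e3 : tmValue (i + 2) / qKL ^ 2 = tmValue i - tm i * (1 / qKL) -
        tm (i + 1) * (1 / qKL ^ 2) := by
      rw [← e1, pow_two, ← div_div, show i + 2 = i + 1 + 1 by rfl, e1]
      field_simp
    have e4 : rval p (fun l => periodic k (i + 2 + l)) / p ^ 2 =
        rval p (fun l => periodic k (i + l)) - tm i * (1 / p) - tm (i + 1) * (1 / p ^ 2) := by
      rw [← e2 i (by omega), pow_two, ← div_div, show i + 2 = i + 1 + 1 by rfl,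
        e2 (i + 1) (by omega)]
      field_simp
    rw [e3, e4]
    have := mul_nonneg (isDigits_tm.nonneg (i + 1)) hpos2
    linarith

/-- The sequences starting at n and at j share their digits through the 1 opening the next block.
Behind it, the first has value more than 1/(`qKL` - 1) - 1 because it follows a 1. -/
theorem tmValue_ge_sub {n k b j : ℕ} (hn : n = 2 ^ k * b + j) (hj : j ≤ 2 ^ k)
    (hj1 : 1 ≤ j) (hb : tm b = 0) (hb1 : tm (b + 1) = 1) :
    tmValue j - (tmValue (2 ^ k + 1) - (1 / (qKL - 1) - 1)) / qKL ^ (2 ^ k - j + 1) ≤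
      tmValue n := by
  have h1 := tmValue_split n (2 ^ k - j)
  have h2 := tmValue_split j (2 ^ k - j)
  have hns : n + (2 ^ k - j) = 2 ^ k * (b + 1) := by rw [mul_add]; omega
  have hm : tm (n + (2 ^ k - j)) = 1 := by rw [hns, tm_pow_mul, hb1]
  have h3 := lt_tmValue_succ (by omega) hm
  rw [Nat.add_sub_cancel' hj, tm_pow] at h2
  rw [hm, Finset.sum_congr rfl fun i hi => by
    have := Finset.mem_range.mp hi
    rw [hn, add_assoc, tm_block_zero (by omega) hb]] at h1
  have hK := one_lt_qKL
  rw [h1, h2, add_sub_assoc, ← sub_div]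
  gcongr
  linarith

/-- A lower bound for `qKL` - p, from the fact that the reflection of τ₁…τ_{2^k}000… has smaller
value in the larger base. -/
theorem gap_mul_ge {p : ℝ} (hp : 1 < p) (hpq : p < qKL) {k : ℕ} (hkp : trunc k p = 1) :
    (qKL - 1) * (p - 1) * tmValue (2 ^ k + 1) ≤ (qKL - p) * qKL ^ 2 ^ k := by
  have hd := IsDigits.splice (isDigits_tm.shift 1) (b := fun _ => 0) (fun _ => Or.inl rfl) (2 ^ k)
  have hv : ∀ q : ℝ, 1 < q → rval q (splice (fun l => tm (1 + l)) (fun _ => 0) (2 ^ k)) =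
      trunc k q := by
    intro q hq
    rw [rval_split hq hd (2 ^ k), trunc, Finset.sum_congr rfl fun i hi => by
      rw [splice_lt (Finset.mem_range.mp hi)]]
    simp [splice_add, rval]
  have h := rval_anti hp hpq.le hd.compl
  have hK := one_lt_qKL
  rw [rval_compl hK hd, rval_compl hp hd, hv _ hp, hv _ hK, hkp, trunc_qKL] at h
  have h1 : 0 < qKL - 1 := by linarith
  have h2 : 0 < p - 1 := by linarith
  have h3 : tmValue (2 ^ k + 1) / qKL ^ 2 ^ k ≤ (qKL - p) / ((qKL - 1) * (p - 1)) := by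
    have e : (qKL - p) / ((qKL - 1) * (p - 1)) = 1 / (p - 1) - 1 / (qKL - 1) := by
      field_simp
      ring
    rw [e]
    linarith
  rw [div_le_div_iff₀ (by positivity) (by positivity)] at h3
  linarith

theorem base_gt {p : ℝ} (hp : 1 < p) {k : ℕ} (hk : 2 ≤ k) (hkp : trunc k p = 1) : 1.75 < p := by
  by_contra hle
  have h1 : 1 < trunc 2 1.75 := by
    rw [trunc_two]
    norm_num
  have h2 := trunc_mono_index (q := 1.75) (by norm_num) hk
  have h3 : trunc k 1.75 ≤ trunc k p := sum_anti hp (not_lt.mp hle) (isDigits_tm.shift 1) _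
  linarith

theorem tmValue_block_le {k : ℕ} (hk : 2 ≤ k) : tmValue (2 ^ k + 1) ≤ (1 / qKL) ^ 2 := by
  have h4 : 2 ^ 2 ≤ 2 ^ k := Nat.pow_le_pow_right two_pos hk
  have h1 := tm_block_one (k := k) (a := 1) (i := 1) (by omega) tm_one
  have h2 := tm_block_one (k := k) (a := 1) (i := 2) (by omega) tm_one
  rw [mul_one, tm_one, sub_self] at h1
  rw [mul_one, tm_two, sub_self] at h2
  rw [tmValue_eq, h1, tmValue_eq (2 ^ k + 1 + 1), add_assoc (2 ^ k), h2, zero_add, zero_add,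
    div_div, div_pow, one_pow, ← pow_two]
  have := tmValue_le_one (n := 2 ^ k + (1 + 1) + 1) (by omega)
  have hK := one_lt_qKL
  gcongr

theorem tmValue_block_le_of_three {k : ℕ} (hk : 3 ≤ k) :
    tmValue (2 ^ k + 1) ≤ (1 / qKL) ^ 3 + (1 / qKL) ^ 5 + (1 / qKL) ^ 6 + (1 / qKL) ^ 7 := by
  have h8 : 2 ^ 3 ≤ 2 ^ k := Nat.pow_le_pow_right two_pos hk
  have h : ∀ i < 8, tm (2 ^ k + i) = 1 - tm i := by
    intro i hi
    have := tm_block_one (k := k) (a := 1) (i := i) (by omega) tm_one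
    rwa [mul_one] at this
  have h1 := tmValue_split (2 ^ k + 1) 6
  simp only [Finset.sum_range_succ, Finset.sum_range_zero, add_assoc] at h1
  norm_num [h, tm_one, tm_two, tm_three, tm_four, tm_five, tm_six, tm_seven] at h1
  rw [h1]
  have := tmValue_le_one (n := 2 ^ k + 8) (by omega)
  have hK := one_lt_qKL
  have e : tmValue (2 ^ k + 8) / qKL ^ 7 ≤ 1 / qKL ^ 7 := by gcongr
  simp only [div_pow, one_pow]
  simp only [one_div] at e ⊢
  linarith

/-- The gain from the change of base (`gain`) outweighs the loss from replacing j = i + z by n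
(`tmValue_ge_sub`). Both scale alike in k, i and z, so one numerical inequality suffices. -/
theorem rval_periodic_le_tmValue {p : ℝ} (hp : 1 < p) (hpq : p < qKL) {k : ℕ} (hk : 2 ≤ k)
    (hkp : trunc k p = 1) {n b i z : ℕ} (hn : n = 2 ^ k * b + (i + z)) (hi : 1 ≤ i) (hz : z ≤ 2)
    (hiz : 2 ≤ i ∨ 1 ≤ z) (hB : i + z ≤ 2 ^ k) (hb : tm b = 0) (hb1 : tm (b + 1) = 1) :
    rval p (fun l => periodic k (i + z + l)) / p ^ z ≤ tmValue n / qKL ^ z := by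
  have hK := one_lt_qKL
  have h1 := gain hp hpq (by omega) hkp hi hz hiz hB
  have h2 := tmValue_ge_sub hn hB (by omega) hb hb1
  have h3 := gap_mul_ge hp hpq hkp
  have h4 := tmValue_block_le hk
  have h5 := base_gt hp hk hkp
  have hc := gap_gt
  have hu := inv_qKL_bounds
  set D := tmValue (2 ^ k + 1) - (1 / (qKL - 1) - 1) with hD
  have hcV := lt_tmValue_succ (Nat.one_le_two_pow) (tm_pow k)
  -- The left side is at most about 0.138; by `gap_mul_ge` the right side is at least about 0.159,
  -- uniformly in k.
  have hmain : D * qKL ^ 2 ≤ (qKL - p) * qKL ^ 2 ^ k := by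
    have hg := qKL_gt
    have hl := qKL_lt
    refine le_trans ?_ h3
    have h6 : D ≤ 0.0431 := by nlinarith
    have h7 : qKL ^ 2 ≤ 3.195 := by nlinarith
    have h8 : 0.59 ≤ (qKL - 1) * (p - 1) := by nlinarith
    have h9 : D * qKL ^ 2 ≤ 0.0431 * 3.195 := mul_le_mul h6 h7 (by positivity) (by norm_num)
    have h10 : 0.59 * 0.2701 ≤ (qKL - 1) * (p - 1) * tmValue (2 ^ k + 1) :=
      mul_le_mul h8 (by linarith) (by norm_num) (by nlinarith)
    linarith
  have h6 : (tmValue (i + z) - D / qKL ^ (2 ^ k - (i + z) + 1)) / qKL ^ z ≤ tmValue n / qKL ^ z := by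
    gcongr
  rw [sub_div, div_div, ← pow_add] at h6
  have h7 : D / qKL ^ (2 ^ k - (i + z) + 1 + z) ≤ (qKL - p) * qKL ^ i / qKL ^ 3 := by
    rw [div_le_div_iff₀ (by positivity) (by positivity)]
    have e : (qKL - p) * qKL ^ i * qKL ^ (2 ^ k - (i + z) + 1 + z) =
        (qKL - p) * qKL ^ 2 ^ k * qKL := by
      rw [mul_assoc, ← pow_add, show i + (2 ^ k - (i + z) + 1 + z) = 2 ^ k + 1 by omega, pow_succ,
        mul_assoc]
    rw [e]
    have := mul_le_mul_of_nonneg_right hmain (by linarith : 0 ≤ qKL)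
    linarith
  linarith

/-- The digits of `n` on begin with `1010011`. -/
def HasPrefix (n : ℕ) : Prop := tm n = 1 ∧ tm (n + 1) = 0 ∧ tm (n + 2) = 1 ∧ tm (n + 3) = 0 ∧
  tm (n + 4) = 0 ∧ tm (n + 5) = 1 ∧ tm (n + 6) = 1

theorem HasPrefix.tmValue_ge {n : ℕ} (h : HasPrefix n) : 0.2463 * qKL ^ 2 ≤ tmValue n := by
  obtain ⟨h0, h1, h2, h3, h4, h5, h6⟩ := h
  have hs := tmValue_split n 6
  have hc := gap_gt.trans (lt_tmValue_succ (by omega) h6)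
  simp only [Finset.sum_range_succ, Finset.sum_range_zero] at hs
  norm_num [h0, h1, h2, h3, h4, h5, h6] at hs
  have hK := one_lt_qKL
  have e : (1 + tmValue (n + 7)) / qKL ^ 7 = (1 + tmValue (n + 7)) * (1 / qKL) ^ 7 := by
    rw [div_pow, one_pow]
    ring
  rw [e, ← inv_pow, ← inv_pow, ← one_div] at hs
  have hu := inv_qKL_bounds.1
  set u := 1 / qKL with hu'
  have p3 : (0.5595 : ℝ) ^ 3 ≤ u ^ 3 := by gcongr
  have p6 : (0.5595 : ℝ) ^ 6 ≤ u ^ 6 := by gcongr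
  have p7 : (0.5595 : ℝ) ^ 7 ≤ u ^ 7 := by gcongr
  have p8 : 1.2701 * (0.5595 : ℝ) ^ 7 ≤ (1 + tmValue (n + 7)) * u ^ 7 :=
    mul_le_mul (by linarith) p7 (by norm_num) (by linarith)
  have hl := qKL_lt
  have : qKL ^ 2 ≤ 1.7873 ^ 2 := by gcongr
  rw [hs]
  norm_num at p3 p6 p8 this ⊢
  linarith

theorem sub_one_div_sq_le {p : ℝ} (hp : 1 < p) (hkp : trunc 2 p = 1) :
    (p - 1) / p ^ 2 ≤ 0.2452 := by
  have h1 : p < 1.755 := by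
    refine lt_of_trunc_lt (by norm_num) hkp ?_
    rw [trunc_two]
    norm_num
  rw [div_le_iff₀ (by positivity)]
  nlinarith

/-- The case of two zeros and offset 2, where `gain` would need i = 0. For k ≥ 3 the gain is that of
(q - 1)/q² between p and `qKL`, at least 0.037 (`qKL` - p), and a sharper bound on D compensates.
For k = 2 the prefix decides: 0.2452 against 0.2463. -/
theorem sub_one_div_sq_le_tmValue {p : ℝ} (hp : 1 < p) (hpq : p < qKL) {k : ℕ} (hk : 2 ≤ k)
    (hkp : trunc k p = 1) {n b : ℕ} (hn : n = 2 ^ k * b + 2) (hb : tm b = 0)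
    (hb1 : tm (b + 1) = 1) (hpre : HasPrefix n) : (p - 1) / p ^ 2 ≤ tmValue n / qKL ^ 2 := by
  have hK := one_lt_qKL
  rcases hk.lt_or_eq with h3 | rfl
  · have h8 : 2 ^ 3 ≤ 2 ^ k := Nat.pow_le_pow_right two_pos h3
    have h2 := tmValue_ge_sub hn (by omega) (by omega) hb hb1
    have h3' := gap_mul_ge hp hpq hkp
    have h4 := tmValue_block_le_of_three h3
    have h5 := base_gt hp hk hkp
    have hc := gap_gt
    obtain ⟨hul, hu⟩ := inv_qKL_bounds
    have hg := qKL_gt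
    have hl := qKL_lt
    have hcV := lt_tmValue_succ (Nat.one_le_two_pow) (tm_pow k)
    rw [tmValue_two] at h2
    set D := tmValue (2 ^ k + 1) - (1 / (qKL - 1) - 1) with hD
    have q3 : (1 / qKL) ^ 3 ≤ (0.5596 : ℝ) ^ 3 := by gcongr
    have q5 : (1 / qKL) ^ 5 ≤ (0.5596 : ℝ) ^ 5 := by gcongr
    have q6 : (1 / qKL) ^ 6 ≤ (0.5596 : ℝ) ^ 6 := by gcongr
    have q7 : (1 / qKL) ^ 7 ≤ (0.5596 : ℝ) ^ 7 := by gcongr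
    have hD1 : D ≤ 0.00795 := by
      norm_num at q3 q5 q6 q7 h4 hc hD ⊢
      linarith
    have h8' : 0.59 ≤ (qKL - 1) * (p - 1) := by nlinarith
    have hE : 0.159 ≤ (qKL - p) * qKL ^ 2 ^ k := by
      have : 0.59 * 0.2701 ≤ (qKL - 1) * (p - 1) * tmValue (2 ^ k + 1) :=
        mul_le_mul h8' (by linarith) (by norm_num) (by nlinarith)
      linarith
    have hfac : 0.037 * (qKL - p) ≤ (qKL - 1) / qKL ^ 2 - (p - 1) / p ^ 2 := by
      have e : (qKL - 1) / qKL ^ 2 - (p - 1) / p ^ 2 =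
          (qKL - p) * (qKL + p - qKL * p) / (qKL ^ 2 * p ^ 2) := by
        field_simp
        ring
      rw [e, le_div_iff₀ (by positivity)]
      have hp2 : qKL ^ 2 * p ^ 2 ≤ 1.7873 ^ 2 * 1.7873 ^ 2 := by
        gcongr
        linarith
      have hp3 : 0.38 ≤ qKL + p - qKL * p := by nlinarith
      have hp4 : 0.037 * (qKL ^ 2 * p ^ 2) ≤ qKL + p - qKL * p := by
        norm_num at hp2 ⊢
        linarith
      have := mul_le_mul_of_nonneg_left hp4 (by linarith : 0 ≤ qKL - p)
      linarith
    have h6 : (qKL - 1 - D / qKL ^ (2 ^ k - 2 + 1)) / qKL ^ 2 ≤ tmValue n / qKL ^ 2 := by gcongr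
    rw [sub_div, div_div, ← pow_add, show 2 ^ k - 2 + 1 + 2 = 2 ^ k + 1 by omega] at h6
    have h7 : D / qKL ^ (2 ^ k + 1) ≤ 0.037 * (qKL - p) := by
      rw [pow_succ, div_le_iff₀ (by positivity)]
      have : 0.159 * 1.787 ≤ (qKL - p) * qKL ^ 2 ^ k * qKL :=
        mul_le_mul hE hg.le (by norm_num) (by linarith)
      linarith
    linarith
  · refine (sub_one_div_sq_le hp hkp).trans ?_
    rw [le_div_iff₀ (by positivity)]
    have := hpre.tmValue_ge
    nlinarith [sq_nonneg qKL]

/-! ### Absence of small univoque bases -/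

theorem blocksReflected_one : BlocksReflected 1 := by
  intro k hk b j h hj _
  have : b = 0 := by
    by_contra hb
    have : 1 * 1 ≤ 2 ^ k * b := Nat.mul_le_mul Nat.one_le_two_pow (by omega)
    omega
  rw [this, zero_add, tm_one]

theorem tmValue_ge_of_one {n : ℕ} (hn : 1 ≤ n) (h : tm n = 1) : 0.71 ≤ tmValue n := by
  rw [tmValue_eq, h]
  have h1 := gap_gt.trans (lt_tmValue_succ hn h)
  have h2 := qKL_lt
  rw [le_div_iff₀ (by linarith [one_lt_qKL])]
  nlinarith

/-- The reflection of e contains 0τ₁…τ_{2^(k-1)}: a reflected block begins halfway, and the final 1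
is exactly the differing digit `e s = 0`. For k = 1 any change of digit suffices. -/
theorem trunc_lt_one_of_block {q : ℝ} (hq : 1 < q) {e : ℕ → ℝ} (he : IsDigits e)
    (hu : Univoque q e) (hpos : 0 < rval q e) {n s k b j : ℕ} (hB : BlocksReflected n)
    (h : ∀ l < s, e l = tm (n + l)) (h0 : e s = 0) (hn : n = 2 ^ k * b + j) (hj : 1 ≤ j)
    (hs : n + s = 2 ^ k * (b + 1)) (hk : 1 ≤ k) (hjk : j ≤ 2 ^ (k - 1)) : trunc k q < 1 := by
  obtain ⟨k, rfl⟩ : ∃ k', k = k' + 1 := ⟨k - 1, by omega⟩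
  rcases Nat.eq_zero_or_pos k with rfl | hk0
  · exact hu.trunc_one_lt hq he h0 hpos
  · rw [Nat.add_sub_cancel] at hjk
    have ep : 2 ^ (k + 1) = 2 * 2 ^ k := pow_succ' 2 k
    have eb : 2 ^ (k + 1) * (b + 1) = 2 ^ k * (2 * b) + 2 * 2 ^ k := by rw [ep]; ring
    have eb2 : 2 ^ (k + 1) * b = 2 ^ k * (2 * b) := by rw [ep]; ring
    have eb3 : 2 ^ k * (2 * b + 1) = 2 ^ k * (2 * b) + 2 ^ k := by ring
    have hb : tm (2 * b + 1) = 1 := hB k hk0 (2 * b) j (by omega) hj hjk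
    have hbl : ∀ l < 2 ^ k, tm (n + (2 ^ k - j + l)) = 1 - tm l := by
      intro l hl
      rw [← tm_block_one hl hb]
      congr 1
      omega
    refine (hu.compl hq he).trunc_lt hq he.compl (P := 2 ^ k - j) (k := k) ?_ fun l hl => ?_
    · have := hbl 0 (by positivity)
      rw [add_zero, tm_zero] at this
      rw [h _ (by omega), this]
      ring
    · rcases Nat.lt_or_ge (1 + l) (2 ^ k) with h1 | h1
      · rw [h _ (by omega), add_assoc (2 ^ k - j), hbl _ h1]
        ring
      · obtain rfl : s = 2 ^ k - j + 1 + l := by omega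
        rw [h0, show 1 + l = 2 ^ k by omega, tm_pow, sub_zero]

theorem exists_unpadded {q : ℝ} {n z : ℕ} (hn : 1 ≤ n) (hq : q ∈ univoqueBases (point z n))
    (hqK : q < qKL) (hB : BlocksReflected n) :
    ∃ k b j s, n = 2 ^ k * b + j ∧ 1 ≤ j ∧ j ≤ 2 ^ k ∧ n + s = 2 ^ k * (b + 1) ∧
      (1 ≤ k → j ≤ 2 ^ (k - 1)) ∧ tm (n + s) = 1 ∧ trunc 1 q < 1 ∧ (1 ≤ k → trunc k q < 1) ∧
      tmValue n / qKL ^ z < roundUp q n s / q ^ z := by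
  obtain ⟨hq1, -, a, ha, hu, hv⟩ := mem_univoqueBases_iff.mp hq
  rw [point_eq] at hv
  obtain ⟨s, hz, hag, h0, h1⟩ := exists_first_difference hq1 hqK ha hn hv
  have he := ha.shift z
  have hue := hu.shift z
  rw [rval_zeros hq1 ha hz] at hv
  have hpos : 0 < rval q (fun l => a (z + l)) := by
    have h2 : 0 < tmValue n / qKL ^ z := by
      have := tmValue_pos n
      have := one_lt_qKL
      positivity
    rw [← hv] at h2
    exact (div_pos_iff_of_pos_right (by positivity)).mp h2
  obtain ⟨k, b, j, hnk, hj, hj2, hs, hk⟩ :=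
    exists_block_of_first_difference hq1 hqK he hue hn hB hag h0 h1
  refine ⟨k, b, j, s, hnk, hj, hj2, hs, hk, h1, hue.trunc_one_lt hq1 he h0 hpos, fun hk1 =>
    trunc_lt_one_of_block hq1 he hue hpos hB hag h0 hnk hj hs hk1 (hk hk1), ?_⟩
  rw [← hv]
  have := rval_lt_roundUp hq1 he hue hag h0
  gcongr

theorem roundUp_one {q : ℝ} {k s : ℕ} (hs : 1 + s = 2 ^ k) : roundUp q 1 s = trunc k q := by
  rw [trunc, show 2 ^ k = s + 1 by omega, Finset.sum_range_succ, hs, tm_pow]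
  rfl

theorem no_small_base_one {q : ℝ} (hq : q ∈ univoqueBases (point 0 1)) : qKL ≤ q := by
  by_contra hlt
  have hqK := not_le.mp hlt
  obtain ⟨k, b, j, s, hn, hj, hj2, hs, hk, h1, ht, htk, hv⟩ :=
    exists_unpadded le_rfl hq hqK blocksReflected_one
  have hb : b = 0 := by
    by_contra hb
    have : 1 * 1 ≤ 2 ^ k * b := Nat.mul_le_mul Nat.one_le_two_pow (by omega)
    omega
  rw [hb, zero_add, mul_one] at hs
  rw [pow_zero, div_one, pow_zero, div_one, tmValue_one, roundUp_one hs] at hv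
  rcases Nat.eq_zero_or_pos k with rfl | hk1
  · exact absurd hv (not_lt.mpr ((trunc_mono_index hq.1 zero_le_one).trans ht.le))
  · exact absurd hv (not_lt.mpr (htk hk1).le)

theorem roundUp_eq_periodic {p : ℝ} (hp : 1 < p) {k : ℕ} (hkp : trunc k p = 1) {n b j s : ℕ}
    (hn : n = 2 ^ k * b + j) (hj : j ≤ 2 ^ k) (hs : n + s = 2 ^ k * (b + 1)) (hb : tm b = 0) :
    roundUp p n s = rval p (fun l => periodic k (j + l)) := by
  rw [mul_add] at hs
  obtain rfl : s = 2 ^ k - j := by omega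
  have e : ∀ l, j + (2 ^ k - j + l) = 2 ^ k + l := by
    intro l
    omega
  rw [rval_split hp ((isDigits_periodic k).shift j) (2 ^ k - j), roundUp]
  simp only [e, periodic_add]
  rw [show rval p (fun l => periodic k l) = rval p (periodic k) from rfl, rval_periodic_cons hp,
    rval_periodic_eq_one hp hkp, div_div, ← pow_succ']
  congr 1
  refine Finset.sum_congr rfl fun i hi => ?_
  have := Finset.mem_range.mp hi
  rw [periodic_of_lt (by omega), hn, add_assoc, tm_block_zero (by omega) hb]

theorem no_small_base {n z : ℕ} (hn : n ∈ S) (hz : z ≤ 2) (h1 : 1 ≤ z → tm n = 1)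
    (h2 : z = 2 → HasPrefix n) {q : ℝ} (hq : q ∈ univoqueBases (point z n)) : qKL ≤ q := by
  by_contra hlt
  have hqK := not_le.mp hlt
  have hn2 := two_le_of_mem_S hn
  obtain ⟨hB, hSt⟩ := (mem_S_iff_conditions hn2).mp hn
  obtain ⟨k, b, j, s, hnk, hj, hj2, hs, hk, hm, ht, htk, hv⟩ :=
    exists_unpadded (by omega) hq hqK hB
  have hq1 : 1 < q := hq.1
  have hK := one_lt_qKL
  have hKl := qKL_lt
  have hsq := add_one_lt_sq_of_trunc hq1 le_rfl ht
  have hg : 1.618 < q := by nlinarith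
  have hginv : 1 / q ≤ 0.6181 := by
    rw [div_le_iff₀ (by linarith)]
    linarith
  have hq0 : 0 ≤ 1 / q := by positivity
  revert hv
  rw [imp_false, not_lt]
  -- For k = 0 the first digit already differs, and 1/q with q above the golden ratio is compared
  -- with x numerically.
  rcases Nat.eq_zero_or_pos k with rfl | hk1
  · obtain rfl : s = 0 := by
      rw [pow_zero, one_mul] at *
      omega
    rw [add_zero] at hm
    have hr : roundUp q n 0 = 1 / q := by simp [roundUp]
    have hv1 := tmValue_ge_of_one (by omega) hm
    rw [hr]
    obtain rfl | rfl | rfl : z = 0 ∨ z = 1 ∨ z = 2 := by omega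
    · rw [pow_zero, div_one, pow_zero, div_one]
      linarith
    · rw [pow_one, pow_one, div_eq_mul_one_div, le_div_iff₀ (by linarith)]
      have : 1 / q * (1 / q) ≤ 0.6181 * 0.6181 := by gcongr
      nlinarith
    · have := (h2 rfl).tmValue_ge
      rw [le_div_iff₀ (by positivity)]
      refine le_trans ?_ this
      gcongr
      have e : 1 / q / q ^ 2 = (1 / q) ^ 3 := by field_simp
      rw [e]
      have : (1 / q) ^ 3 ≤ 0.6181 ^ 3 := by gcongr
      norm_num at this ⊢
      linarith
  · have hjk := hk hk1
    rcases Nat.lt_or_eq_of_le (show 1 ≤ k from hk1) with hk2 | rfl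
    -- Since j lies in the first half, block 2b + 1 of length 2^(k-1) is the next one and is
    -- reflected.
    · have hb : tm b = 0 := by
        obtain ⟨r, rfl⟩ : ∃ r, k = r + 1 := ⟨k - 1, by omega⟩
        have := hB r (by omega) (2 * b) j (by rw [hnk, pow_succ]; ring) hj hjk
        rw [tm_odd] at this
        linarith
      have hb1 : tm (b + 1) = 1 := hB k hk1 b j hnk hj hj2
      have hjne : j ≠ 1 := by
        rintro rfl
        have := hSt k hk1 b hnk
        rw [hb] at this
        norm_num at this
      obtain ⟨p, hp, hpK, hkp⟩ := exists_base hk1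
      have hp1 : 1 < p := by linarith
      have hpq := lt_of_trunc_lt hq1 hkp (htk hk1)
      have hle : roundUp q n s / q ^ z ≤ rval p (fun l => periodic k (j + l)) / p ^ z := by
        rw [← roundUp_eq_periodic hp1 hkp hnk hj2 hs hb]
        have hr := roundUp_anti hp1 hpq.le n s
        have : 0 ≤ roundUp p n s := by
          rw [roundUp_eq_periodic hp1 hkp hnk hj2 hs hb]
          exact rval_nonneg hp1 ((isDigits_periodic k).shift j)
        gcongr
      refine hle.trans ?_
      by_cases hjz : z < j
      · obtain ⟨i, rfl⟩ : ∃ i, j = i + z := ⟨j - z, by omega⟩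
        exact rval_periodic_le_tmValue hp1 hpK hk2 hkp hnk (by omega) hz (by omega) hj2 hb hb1
      -- `StartsReflected` excludes j = 1, so j ≤ z leaves only j = z = 2.
      · obtain rfl : z = 2 := by omega
        obtain rfl : j = 2 := by omega
        rw [rval_periodic_two hp1 hk1 hkp]
        exact sub_one_div_sq_le_tmValue hp1 hpK hk2 hkp hnk hb hb1 (h2 rfl)
    · obtain rfl : j = 1 := by
        rw [Nat.sub_self, pow_zero] at hjk
        omega
      have hb := hSt 1 le_rfl b hnk
      have hn0 : tm n = 0 := by
        rw [hnk, pow_one, tm_odd, hb, sub_self]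
      obtain rfl : z = 0 := by
        by_contra hz0
        rw [h1 (by omega)] at hn0
        norm_num at hn0
      obtain rfl : s = 1 := by
        rw [pow_one] at hs hnk
        omega
      have hr : roundUp q n 1 = (1 / q) * (1 / q) := by
        simp [roundUp, hn0]
        ring
      rw [pow_zero, div_one, pow_zero, div_one, hr, tmValue_eq, hn0, zero_add]
      have hv1 := tmValue_ge_of_one (by omega) hm
      have : 1 / q * (1 / q) ≤ 0.6181 * 0.6181 := by gcongr
      rw [le_div_iff₀ (by linarith)]
      nlinarith

/-! ### Two leading zeros -/

/-- The competing expansion is r + 2 zeros followed by 1010…, where 1010… has value 1 in the golden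
base and less than 1 in base `qKL`. -/
theorem exists_of_golden {n r : ℕ} (hup : tmValue n * (1 / qKL) ^ 2 < 0.618 ^ (r + 2))
    (hlo : (1 / qKL) ^ r ≤ tmValue n) : ∃ q ∈ univoqueBases (point 2 n), q < qKL := by
  obtain ⟨p, hp, hpK, hkp⟩ := exists_base le_rfl
  have hp1 : 1 < p := by linarith
  have hd := (isDigits_periodic 1).shift 1
  have hlt : ∀ q : ℝ, 1 < q → ∀ x : ℝ, 0 ≤ x → x < 1 → x / q ^ r < 1 := fun q hq x hx hx1 =>
    (div_le_self hx (one_le_pow₀ hq.le)).trans_lt hx1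
  have hpg : 0.618 < 1 / p := by
    rw [trunc_one] at hkp
    have hkp : p + 1 = p ^ 2 := by
      field_simp at hkp
      linarith
    rw [lt_div_iff₀ (by linarith)]
    nlinarith
  refine exists_univoque_point_lt 2 hp1 hpK (hd.padded r) (fun q hq _ => ?_) ?_ ?_
  · have hu := univoque_periodic (hp1.trans hq) le_rfl (trunc_lt_of_lt hp1 hkp hq) 1
    refine ⟨hu.1.padded (hp1.trans hq) hd hu.2 r, ?_⟩
    rw [rval_padded (hp1.trans hq) hd]
    exact hlt q (hp1.trans hq) _ (rval_nonneg (hp1.trans hq) hd) hu.2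
  · rw [rval_padded hp1 hd, rval_periodic_eq_one hp1 hkp, div_div, ← pow_add]
    have e : tmValue n / qKL ^ 2 = tmValue n * (1 / qKL) ^ 2 := by
      rw [div_pow, one_pow]
      ring
    rw [e]
    refine hup.trans ?_
    rw [← one_div_pow]
    exact pow_lt_pow_left₀ hpg (by norm_num) (by omega)
  · rw [rval_padded one_lt_qKL hd]
    refine lt_of_lt_of_le ?_ hlo
    have := rval_periodic_lt_one one_lt_qKL (trunc_qKL_lt 1)
    have hK := one_lt_qKL
    rw [div_pow, one_pow]
    gcongr

theorem tmValue_eq_mul (n : ℕ) : tmValue n = 1 / qKL * (tm n + tmValue (n + 1)) := by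
  rw [tmValue_eq]
  ring

theorem exists_of_odd {b : ℕ} (h0 : tm b = 1) (h1 : tm (b + 1) = 1) :
    ∃ q ∈ univoqueBases (point 2 (2 * b + 1)), q < qKL := by
  have h2 := (tm_no_cube (h0.trans h1.symm)).1
  rw [h0, sub_self] at h2
  have d0 : tm (2 * b + 1) = 0 := by rw [tm_odd, h0, sub_self]
  have d1 : tm (2 * b + 2) = 1 := by rw [show 2 * b + 2 = 2 * (b + 1) by ring, tm_even, h1]
  have d2 : tm (2 * b + 3) = 0 := by
    rw [show 2 * b + 3 = 2 * (b + 1) + 1 by ring, tm_odd, h1, sub_self]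
  have d3 : tm (2 * b + 4) = 0 := by rw [show 2 * b + 4 = 2 * (b + 2) by ring, tm_even, h2]
  have hV := tmValue_eq_mul (2 * b + 1)
  rw [d0, tmValue_eq_mul (2 * b + 2), d1, tmValue_eq_mul (2 * b + 3), d2,
    tmValue_eq_mul (2 * b + 4), d3] at hV
  have h5 := tmValue_le_one (n := 2 * b + 5) (by omega)
  have h5' := tmValue_pos (2 * b + 5)
  obtain ⟨hul, hu⟩ := inv_qKL_bounds
  set u := 1 / qKL with hu'
  have hu0 : 0 < u := by linarith
  refine exists_of_golden (r := 2) ?_ ?_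
  · have e : tmValue (2 * b + 1) * u ^ 2 = u ^ 4 + u ^ 6 * tmValue (2 * b + 5) := by
      rw [hV]
      ring
    rw [← hu', e]
    have q4 : u ^ 4 ≤ 0.5596 ^ 4 := by gcongr
    have q6 : u ^ 6 * tmValue (2 * b + 5) ≤ 0.5596 ^ 6 * 1 := by gcongr
    norm_num at q4 q6 ⊢
    linarith
  · have e : tmValue (2 * b + 1) = u ^ 2 + u ^ 4 * tmValue (2 * b + 5) := by
      rw [hV]
      ring
    rw [e]
    have : 0 ≤ u ^ 4 * tmValue (2 * b + 5) := by positivity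
    linarith

theorem tmValue_even_le (i : ℕ) : tmValue (2 * i) ≤ 1 / qKL + (1 / qKL) ^ 2 := by
  have hV := tmValue_eq_mul (2 * i)
  rw [tm_even, tmValue_eq_mul (2 * i + 1), tm_odd] at hV
  have h := tmValue_le_one (n := 2 * i + 1 + 1) (by omega)
  have hu := inv_qKL_bounds.1
  have hu2 := inv_qKL_bounds.2
  rw [hV]
  rcases isDigits_tm i with h0 | h0 <;> rw [h0] <;> nlinarith

theorem exists_of_one_zero {a : ℕ} (h0 : tm a = 1) (h1 : tm (a + 1) = 0) :
    ∃ q ∈ univoqueBases (point 2 (2 * a)), q < qKL := by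
  have d0 : tm (2 * a) = 1 := by rw [tm_even, h0]
  have d1 : tm (2 * a + 1) = 0 := by rw [tm_odd, h0, sub_self]
  have d2 : tm (2 * a + 2) = 0 := by rw [show 2 * a + 2 = 2 * (a + 1) by ring, tm_even, h1]
  have d3 : tm (2 * a + 3) = 1 := by
    rw [show 2 * a + 3 = 2 * (a + 1) + 1 by ring, tm_odd, h1, sub_zero]
  have hV := tmValue_eq_mul (2 * a)
  rw [d0, tmValue_eq_mul (2 * a + 1), d1, tmValue_eq_mul (2 * a + 2), d2,
    tmValue_eq_mul (2 * a + 3), d3] at hV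
  have h4 := tmValue_even_le (a + 2)
  rw [show 2 * (a + 2) = 2 * a + 4 by ring] at h4
  have h4' := tmValue_pos (2 * a + 4)
  obtain ⟨hul, hu⟩ := inv_qKL_bounds
  set u := 1 / qKL with hu'
  have hu0 : 0 < u := by linarith
  refine exists_of_golden (r := 1) ?_ ?_
  · have e : tmValue (2 * a) * u ^ 2 = u ^ 3 + u ^ 6 * (1 + tmValue (2 * a + 4)) := by
      rw [hV]
      ring
    rw [← hu', e]
    have q3 : u ^ 3 ≤ 0.5596 ^ 3 := by gcongr
    have h4'' : tmValue (2 * a + 4) ≤ 0.5596 + 0.5596 ^ 2 := h4.trans (by gcongr)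
    have q6 : u ^ 6 * (1 + tmValue (2 * a + 4)) ≤ 0.5596 ^ 6 * (1 + (0.5596 + 0.5596 ^ 2)) := by
      gcongr
    norm_num at q3 q6 ⊢
    linarith
  · have e : tmValue (2 * a) = u + u ^ 4 * (1 + tmValue (2 * a + 4)) := by
      rw [hV]
      ring
    rw [e, pow_one]
    have : 0 ≤ u ^ 4 * (1 + tmValue (2 * a + 4)) := by positivity
    linarith

/-- The digits from 2a on are 101001011001. The competitor is 00 followed by 10 and the repetition
of 0110, whose value (p - 1)/p² in base p₂ lies just above x; the numerical margins are
correspondingly thin. -/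
theorem exists_of_one_one_zero_zero_one_zero {a : ℕ} (h0 : tm a = 1) (h1 : tm (a + 1) = 1)
    (h2 : tm (a + 2) = 0) (h3 : tm (a + 3) = 0) (h4 : tm (a + 4) = 1) (h5 : tm (a + 5) = 0) :
    ∃ q ∈ univoqueBases (point 2 (2 * a)), q < qKL := by
  have dig : ∀ i, tm (2 * a + 2 * i) = tm (a + i) ∧ tm (2 * a + 2 * i + 1) = 1 - tm (a + i) := by
    intro i
    rw [← mul_add, tm_even, tm_odd]
    exact ⟨rfl, rfl⟩
  have hV := tmValue_split (2 * a) 11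
  obtain ⟨d0, d1⟩ := dig 0
  obtain ⟨d2, d3⟩ := dig 1
  obtain ⟨d4, d5⟩ := dig 2
  obtain ⟨d6, d7⟩ := dig 3
  obtain ⟨d8, d9⟩ := dig 4
  obtain ⟨d10, d11⟩ := dig 5
  rw [add_zero, h0] at d1
  rw [add_zero, h0] at d0
  rw [h1] at d2 d3
  rw [h2] at d4 d5
  rw [h3] at d6 d7
  rw [h4] at d8 d9
  rw [h5] at d10 d11
  simp only [Finset.sum_range_succ, Finset.sum_range_zero] at hV
  norm_num [add_assoc] at d0 d1 d2 d3 d4 d5 d6 d7 d8 d9 d10 d11 hV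
  norm_num [d0, d1, d2, d3, d4, d5, d6, d7, d8, d9, d10, d11] at hV
  have ht := tmValue_le_one (n := 2 * a + 12) (by omega)
  have ht' := tmValue_pos (2 * a + 12)
  have e12 : (1 + tmValue (2 * a + 12)) / qKL ^ 12 = (1 + tmValue (2 * a + 12)) * (1 / qKL) ^ 12 := by
    rw [div_pow, one_pow]
    ring
  rw [e12] at hV
  simp only [← inv_pow] at hV
  simp only [← one_div] at hV
  obtain ⟨hul, hu⟩ := inv_qKL_bounds
  obtain ⟨p, hp, hpK, hkp⟩ := exists_base (k := 2) (by norm_num)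
  have hp1 : 1 < p := by linarith
  have hpl : 1.7548 < p := by
    by_contra hle
    have h1 : 1 < trunc 2 1.7548 := by
      rw [trunc_two]
      norm_num
    have h3 : trunc 2 1.7548 ≤ trunc 2 p := sum_anti hp1 (not_lt.mp hle) (isDigits_tm.shift 1) _
    linarith
  have hpg : 0.2451 ≤ (p - 1) / p ^ 2 := by
    rw [le_div_iff₀ (by positivity)]
    have := qKL_lt
    nlinarith
  refine exists_univoque_point_lt 2 hp1 hpK ((isDigits_periodic 2).shift 2)
    (fun q hq _ => univoque_periodic (hp1.trans hq) (by norm_num) (trunc_lt_of_lt hp1 hkp hq) 2)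
    ?_ ?_
  · rw [rval_periodic_two hp1 (by norm_num) hkp]
    refine lt_of_lt_of_le ?_ hpg
    have e : tmValue (2 * a) / qKL ^ 2 = tmValue (2 * a) * (1 / qKL) ^ 2 := by
      rw [div_pow, one_pow]
      ring
    rw [e, hV]
    set u := 1 / qKL with hu'
    have hu0 : 0 < u := by linarith
    have q3 : u ^ 3 ≤ 0.5596 ^ 3 := by gcongr
    have q5 : u ^ 5 ≤ 0.5596 ^ 5 := by gcongr
    have q8 : u ^ 8 ≤ 0.5596 ^ 8 := by gcongr
    have q10 : u ^ 10 ≤ 0.5596 ^ 10 := by gcongr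
    have q11 : u ^ 11 ≤ 0.5596 ^ 11 := by gcongr
    have q14 : (1 + tmValue (2 * a + 12)) * u ^ 14 ≤ (1 + 1) * 0.5596 ^ 14 := by gcongr
    norm_num at q3 q5 q8 q10 q11 q14 ⊢
    ring_nf at q14 ⊢
    linarith
  · have hK := one_lt_qKL
    have e4 : rval qKL (fun l => periodic 2 (2 + 1 + 1 + l)) = rval qKL (periodic 2) :=
      rval_congr fun l => periodic_add 2 l
    rw [rval_shift_cons hK (isDigits_periodic 2) 2, periodic_of_lt (by norm_num), tm_two,
      rval_shift_cons hK (isDigits_periodic 2) (2 + 1), periodic_of_lt (by norm_num), tm_three,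
      e4, rval_periodic_cons hK, hV]
    have hlt := rval_periodic_lt_one hK (trunc_qKL_lt 2)
    set u := 1 / qKL with hu'
    have hu0 : 0 < u := by linarith
    have e : ∀ x : ℝ, (1 + (0 + x / qKL) / qKL) / qKL = u + u ^ 3 * x := by
      intro x
      rw [hu']
      field_simp
      ring
    rw [e]
    have p1 : 0 < u ^ 6 := by positivity
    have p2 : 0 < u ^ 8 := by positivity
    have p3 : 0 < u ^ 9 := by positivity
    have p4 : 0 < (1 + tmValue (2 * a + 12)) * u ^ 12 := by positivity
    have p5 : u ^ 3 * rval qKL (fun l => periodic 2 (1 + l)) ≤ u ^ 3 * 1 := by gcongr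
    linarith

/-- Membership in `S` leaves few beginnings: 0100 for odd n; for even n = 2a, 1001 or the doubling
of 1100 or 1101. The last gives the prefix. -/
theorem exists_of_not_hasPrefix {n : ℕ} (hn : n ∈ S) (h : ¬ HasPrefix n) :
    ∃ q ∈ univoqueBases (point 2 n), q < qKL := by
  obtain ⟨hB, hSt⟩ := (mem_S_iff_conditions (two_le_of_mem_S hn)).mp hn
  have hn2 := two_le_of_mem_S hn
  rcases Nat.even_or_odd' n with ⟨a, rfl | rfl⟩
  · have h0 : tm a = 1 := by
      have := hB 1 le_rfl (a - 1) 2 (by omega) (by norm_num) (by norm_num)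
      rwa [Nat.sub_add_cancel (by omega)] at this
    rcases isDigits_tm (a + 1) with h1 | h1
    · exact exists_of_one_zero h0 h1
    obtain ⟨h2, b, rfl⟩ := tm_no_cube (h0.trans h1.symm)
    rw [h0, sub_self] at h2
    rcases isDigits_tm (2 * b + 1 + 3) with h3 | h3
    · have hb0 : tm b = 0 := by
        rw [tm_odd] at h0
        linarith
      have hb1 : tm (b + 1) = 1 := by
        rwa [show 2 * b + 1 + 1 = 2 * (b + 1) by ring, tm_even] at h1
      have hb2 : tm (b + 2) = 0 := by
        rwa [show 2 * b + 1 + 3 = 2 * (b + 2) by ring, tm_even] at h3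
      have h4 : tm (2 * b + 1 + 4) = 1 := by
        rw [show 2 * b + 1 + 4 = 2 * (b + 2) + 1 by ring, tm_odd, hb2, sub_zero]
      rcases Nat.even_or_odd' b with ⟨c, rfl | rfl⟩
      -- With b = 2c one has n = 8c + 2, and the condition on blocks of length 8 contradicts `hb2`.
      -- So b is odd, which determines the two further digits needed.
      · have hc := hB 3 (by norm_num) c 2 (by ring) (by norm_num) (by norm_num)
        rw [show 2 * c + 2 = 2 * (c + 1) by ring, tm_even, hc] at hb2
        norm_num at hb2
      · have hc0 : tm c = 1 := by
          rw [tm_odd] at hb0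
          linarith
        have hc1 : tm (c + 1) = 1 := by
          rwa [show 2 * c + 1 + 1 = 2 * (c + 1) by ring, tm_even] at hb1
        have hc2 := (tm_no_cube (hc0.trans hc1.symm)).1
        refine exists_of_one_one_zero_zero_one_zero h0 h1 h2 h3 h4 ?_
        rw [show 2 * (2 * c + 1) + 1 + 5 = 2 * (2 * (c + 2)) by ring, tm_even, tm_even, hc2, hc0,
          sub_self]
    · refine absurd ⟨?_, ?_, ?_, ?_, ?_, ?_, ?_⟩ h
      · rw [tm_even, h0]
      · rw [tm_odd, h0, sub_self]
      · rw [show 2 * (2 * b + 1) + 2 = 2 * (2 * b + 1 + 1) by ring, tm_even, h1]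
      · rw [show 2 * (2 * b + 1) + 3 = 2 * (2 * b + 1 + 1) + 1 by ring, tm_odd, h1, sub_self]
      · rw [show 2 * (2 * b + 1) + 4 = 2 * (2 * b + 1 + 2) by ring, tm_even, h2]
      · rw [show 2 * (2 * b + 1) + 5 = 2 * (2 * b + 1 + 2) + 1 by ring, tm_odd, h2, sub_zero]
      · rw [show 2 * (2 * b + 1) + 6 = 2 * (2 * b + 1 + 3) by ring, tm_even, h3]
  · exact exists_of_odd (hSt 1 le_rfl a (by omega))
      (hB 1 le_rfl a 1 (by omega) le_rfl (by norm_num))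

/-! ### The level set and the density of the index set -/

theorem qs_point_of_mem {n z : ℕ} (hn : n ∈ S) (hz : z ≤ 2) (h1 : 1 ≤ z → tm n = 1)
    (h2 : z = 2 → HasPrefix n) : qs (point z n) = qKL := by
  have := two_le_of_mem_S hn
  exact qs_point_eq (by omega) (by omega) fun q hq => no_small_base hn hz h1 h2 hq

theorem two_pow_mem_S (k : ℕ) : 2 ^ (k + 1) ∈ S := by
  induction k using Nat.twoStepInduction with
  | zero => exact MemS.two
  | one => exact MemS.four
  | more k ih _ =>
    have e : 2 ^ (k + 2 + 1) = 4 * 2 ^ (k + 1) := by ring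
    have e2 : 2 ^ (k + 2) = 2 * 2 ^ (k + 1) := by ring
    have hp := Nat.two_pow_pos (k + 1)
    refine (mem_S_iff (k := k + 2) (by omega) (by omega) le_rfl).mpr ?_
    rw [show k + 2 - 1 = k + 1 by omega, e, show 4 * 2 ^ (k + 1) - 3 * 2 ^ (k + 1) = 2 ^ (k + 1) by
      omega]
    exact ⟨by omega, ih⟩

/-- By uniqueness of expansions, equal values would mean equal sequences, but these differ at offset
2^k. -/
theorem tmValue_two_pow_ne {k l : ℕ} (h : k < l) : tmValue (2 ^ k) ≠ tmValue (2 ^ l) := by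
  intro he
  have hu := (univoque_tm (Nat.one_le_two_pow (n := k))).unique one_lt_qKL
    (isDigits_tm.shift (2 ^ k)) (isDigits_tm.shift (2 ^ l)) he.symm
  have h1 : tm (2 ^ l + 2 ^ k) = tm (2 ^ k + 2 ^ k) := congrFun hu (2 ^ k)
  have h2 := tm_block_one (k := l) (a := 1) (i := 2 ^ k)
    (Nat.pow_lt_pow_right (by norm_num) h) tm_one
  rw [mul_one, h1, ← mul_two, ← pow_succ, tm_pow, tm_pow] at h2
  norm_num at h2

theorem levelSet_infinite : (levelSet qKL).Infinite := by
  refine Set.infinite_of_injective_forall_mem (f := fun k : ℕ => point 0 (2 ^ (k + 1))) ?_ ?_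
  · intro k l h
    simp only [point_eq, pow_zero, div_one] at h
    rcases lt_trichotomy k l with hkl | hkl | hkl
    · exact absurd h (tmValue_two_pow_ne (by omega))
    · exact hkl
    · exact absurd h.symm (tmValue_two_pow_ne (by omega))
  · intro k
    refine ⟨?_, qs_point_of_mem (two_pow_mem_S k) (by omega) (by omega) (by omega)⟩
    rw [point_eq, pow_zero, div_one]
    exact tmValue_pos _

theorem ncard_S_step {k : ℕ} (hk : 2 ≤ k) : (S ∩ Set.Icc 1 (2 ^ (k + 1))).ncard ≤
    (S ∩ Set.Icc 1 (2 ^ k)).ncard + (S ∩ Set.Icc 1 (2 ^ (k - 1))).ncard := by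
  have hfin : ∀ N, (S ∩ Set.Icc 1 N).Finite := fun N => (Set.finite_Icc 1 N).inter_of_right S
  have hsub : S ∩ Set.Icc 1 (2 ^ (k + 1)) ⊆ (S ∩ Set.Icc 1 (2 ^ k)) ∪
      (fun n => n + 3 * 2 ^ (k - 1)) '' (S ∩ Set.Icc 1 (2 ^ (k - 1))) := by
    rintro n ⟨hn, h1, h2⟩
    rcases Nat.lt_or_ge (2 ^ k) n with h3 | h3
    · right
      obtain ⟨h4, h5⟩ := (mem_S_iff hk h3 h2).mp hn
      have e : 2 ^ (k + 1) = 4 * 2 ^ (k - 1) := by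
        rw [show k + 1 = k - 1 + 2 by omega, pow_add]
        ring
      exact ⟨n - 3 * 2 ^ (k - 1), ⟨h5, by omega, by omega⟩, Nat.sub_add_cancel h4.le⟩
    · exact Or.inl ⟨hn, h1, h3⟩
  calc _ ≤ _ := Set.ncard_le_ncard hsub ((hfin _).union ((hfin _).image _))
    _ ≤ _ := Set.ncard_union_le _ _
    _ ≤ _ := Nat.add_le_add_left (Set.ncard_image_le (hfin _)) _

theorem ncard_S_le_self (n : ℕ) : (S ∩ Set.Icc 1 n).ncard ≤ n := by
  refine (Set.ncard_le_ncard Set.inter_subset_right (Set.finite_Icc 1 n)).trans ?_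
  rw [← Finset.coe_Icc, Set.ncard_coe_finset, Nat.card_Icc, Nat.add_sub_cancel]

/-- Any rate r < 2 with r + 1 ≤ r² works in the Fibonacci-type recursion; 7/4 is a convenient one.
-/
theorem ncard_S_le (k : ℕ) :
    ((S ∩ Set.Icc 1 (2 ^ k)).ncard : ℝ) ≤ 2 * (7 / 4) ^ k := by
  have small : ∀ k, ((S ∩ Set.Icc 1 (2 ^ k)).ncard : ℝ) ≤ 2 ^ k := fun k => by
    exact_mod_cast ncard_S_le_self (2 ^ k)
  induction k using Nat.strong_induction_on with
  | _ k ih =>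
    rcases Nat.lt_or_ge k 3 with h | h
    · refine (small k).trans ?_
      interval_cases k <;> norm_num
    · obtain ⟨k, rfl⟩ : ∃ r, k = r + 3 := ⟨k - 3, by omega⟩
      have h1 : ((S ∩ Set.Icc 1 (2 ^ (k + 3))).ncard : ℝ) ≤
          (S ∩ Set.Icc 1 (2 ^ (k + 2))).ncard + (S ∩ Set.Icc 1 (2 ^ (k + 1))).ncard := by
        exact_mod_cast ncard_S_step (k := k + 2) (by omega)
      have h2 := ih (k + 2) (by omega)
      have h3 := ih (k + 1) (by omega)
      have h4 : (0 : ℝ) < (7 / 4) ^ k := by positivity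
      rw [pow_add (7 / 4 : ℝ)] at h2 h3 ⊢
      norm_num at h2 h3 ⊢
      linarith

theorem density_S :
    Tendsto (fun n : ℕ => ((S ∩ Set.Icc 1 n).ncard : ℝ) / (n : ℝ)) atTop (𝓝 0) := by
  have hlog : Tendsto (Nat.log 2) atTop atTop :=
    tendsto_atTop_atTop_of_monotone Nat.log_monotone fun k =>
      ⟨2 ^ k, (Nat.log_pow (by norm_num) k).ge⟩
  have hlim : Tendsto (fun n : ℕ => (7 / 2 : ℝ) * (7 / 8) ^ Nat.log 2 n) atTop (𝓝 0) := by
    simpa using ((tendsto_pow_atTop_nhds_zero_of_lt_one (r := (7 / 8 : ℝ)) (by norm_num)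
      (by norm_num)).comp hlog).const_mul (7 / 2)
  refine squeeze_zero' (Eventually.of_forall fun n => by positivity) ?_ hlim
  filter_upwards [eventually_ge_atTop 1] with n hn
  have h1 : 2 ^ Nat.log 2 n ≤ n := Nat.pow_log_le_self 2 (by omega)
  have h2 : n ≤ 2 ^ (Nat.log 2 n + 1) := (Nat.lt_pow_succ_log_self (by norm_num) n).le
  generalize Nat.log 2 n = k at h1 h2
  have h3 : (S ∩ Set.Icc 1 n).ncard ≤ (S ∩ Set.Icc 1 (2 ^ (k + 1))).ncard :=
    Set.ncard_le_ncard (Set.inter_subset_inter_right _ (Set.Icc_subset_Icc_right h2))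
      ((Set.finite_Icc 1 _).inter_of_right S)
  have h4 : ((S ∩ Set.Icc 1 n).ncard : ℝ) ≤ 2 * (7 / 4) ^ (k + 1) :=
    (Nat.cast_le.mpr h3).trans (ncard_S_le (k + 1))
  have h5 : (2 : ℝ) ^ k ≤ n := by exact_mod_cast h1
  calc ((S ∩ Set.Icc 1 n).ncard : ℝ) / n ≤ 2 * (7 / 4) ^ (k + 1) / 2 ^ k := by gcongr
    _ = 7 / 2 * (7 / 8) ^ k := by
      rw [pow_succ, show (7 / 8 : ℝ) = 7 / 4 / 2 by norm_num, div_pow (7 / 4 : ℝ)]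
      ring

theorem hasPrefix_iff (n : ℕ) :
    (fun i : Fin 7 => tau (n + i)) = ![1, 0, 1, 0, 0, 1, 1] ↔ HasPrefix n := by
  simp [funext_iff, Fin.forall_fin_succ, HasPrefix, tau_eq_iff]

end ThueMorseBases

open ThueMorseBases

theorem theorem5p2 :
    -- the level set of the Komornik–Loreti constant is infinite
    (ThueMorseBases.levelSet ThueMorseBases.qKL).Infinite ∧
    -- the points with no leading zero
    (∀ n : ℕ, 1 ≤ n →
      (ThueMorseBases.qs (ThueMorseBases.point 0 n) = ThueMorseBases.qKL ↔
        n ∈ ThueMorseBases.S ∪ {1})) ∧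
    -- the points with one leading zero
    (∀ n : ℕ, 1 ≤ n → ThueMorseBases.tau n = 1 →
      (ThueMorseBases.qs (ThueMorseBases.point 1 n) = ThueMorseBases.qKL ↔
        n ∈ ThueMorseBases.S)) ∧
    -- the points with two leading zeros
    (∀ n : ℕ, 1 ≤ n →
      (ThueMorseBases.qs (ThueMorseBases.point 2 n) = ThueMorseBases.qKL ↔
        n ∈ ThueMorseBases.S ∧
          (fun i : Fin 7 => ThueMorseBases.tau (n + i)) = ![1, 0, 1, 0, 0, 1, 1])) ∧
    -- in all of these cases the infimum is attained
    (∀ n k : ℕ, 1 ≤ n → k ≤ 2 →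
      ThueMorseBases.qs (ThueMorseBases.point k n) = ThueMorseBases.qKL →
        IsLeast (ThueMorseBases.univoqueBases (ThueMorseBases.point k n)) ThueMorseBases.qKL) ∧
    -- the set `S` has density zero
    Tendsto (fun n : ℕ => ((ThueMorseBases.S ∩ Set.Icc 1 n).ncard : ℝ) / (n : ℝ))
      atTop (𝓝 0) := by
  refine ⟨levelSet_infinite, fun n hn => ⟨fun h => ?_, ?_⟩, fun n hn hτ => ⟨fun h => ?_, fun h => ?_⟩,
    fun n hn => ⟨fun h => ?_, ?_⟩, fun n k hn _ h => ⟨?_, fun q hq => ?_⟩, density_S⟩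
  · by_contra hS
    rw [Set.mem_union, not_or] at hS
    exact qs_ne_of_exists (exists_of_not_mem_S hn hS.1 fun h1 => absurd h1 hS.2) h
  · rintro (hS | rfl)
    · exact qs_point_of_mem hS (by omega) (by omega) (by omega)
    · exact qs_point_eq le_rfl (fun _ => rfl) fun q hq => no_small_base_one hq
  · by_contra hS
    exact qs_ne_of_exists (exists_of_not_mem_S hn hS fun _ => le_rfl) h
  · refine qs_point_of_mem h (by omega) (fun _ => ?_) (by omega)
    simpa using tau_eq_iff.mp hτ
  · have hS : n ∈ S := by
      by_contra hS
      exact qs_ne_of_exists (exists_of_not_mem_S hn hS fun _ => by omega) h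
    refine ⟨hS, (hasPrefix_iff n).mpr ?_⟩
    by_contra hp
    exact qs_ne_of_exists (exists_of_not_hasPrefix hS hp) h
  · rintro ⟨hS, hp⟩
    have hp := (hasPrefix_iff n).mp hp
    exact qs_point_of_mem hS le_rfl (fun _ => hp.1) fun _ => hp
  · refine qKL_mem hn ?_
    rintro rfl
    by_contra hk
    exact qs_ne_of_exists (exists_of_one (by omega)) h
  · rw [← h]
    exact csInf_le (bddBelow_univoqueBases _) hq
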